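/- Let $k\ge 1$ be an integer. A family of distinct sets is a *sunflower* if any two distinct members intersect exactly in the common intersection of all members; this common intersection is its *kernel*, and its members are its *petals*. For $L\subseteq\{0,1,\dots,k-1\}$, an *$L$-sunflower* is a sunflower whose kernel has size in $L$; an *$L$-clique* of size $m$ is a collection of $m$ distinct sets any two of which have intersection size in $L$; and a family *avoids intersections of size in $L$* if no two distinct members have intersection size in $L$. There are constants $c,C>0$, depending only on $k$, such that the following holds for every $L\subseteq\{0,1,\dots,k-1\}$ and every integer $m\ge 2$. Put $a=\min\{i\ge 0: i\notin L\}$ and $b=\min\{i\ge a: i\in L\text{ or } i=k\}$. 1. Every finite family $\mathcal F$ of $k$-element sets which contains no $L$-sunflower with $m$ petals (in particular, every finite family of $k$-element sets with no $L$-clique of size $m$, since such a family contains no $L$-sunflower with $m$ petals) has a subfamily $\mathcal F'\subseteq\mathcal F$ that avoids intersections of size in $L$ and satisfies $|\mathcal F'|\ge c\, m^{-k+b-a}|\mathcal F|$. 2. This bound is tight for $L$-sunflowers: there is a non-empty finite family $\mathcal F$ of $k$-element sets which contains no $L$-sunflower with $m$ petals, such that every subfamily $\mathcal F'\subseteq\mathcal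 F$ that avoids intersections of size in $L$ satisfies $|\mathcal F'|\le C\, m^{-k+b-a}|\mathcal F|$. -/

import Mathlib

/-- Every member of the family `F` has exactly `k` elements. -/
def IsUniform {α : Type*} (k : ℕ) (F : Finset (Finset α)) : Prop :=
  ∀ A ∈ F, A.card = k

/-- The common intersection of all members of a (non-empty) family `S`. -/
def kernel {α : Type*} [DecidableEq α] (S : Finset (Finset α)) : Finset α :=
  (S.biUnion id).filter fun x => ∀ A ∈ S, x ∈ A

/-- A family of (distinct) sets is a sunflower if any two of its members meet exactly in the
common intersection of all members. Its petals are its members. -/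
def IsSunflower {α : Type*} [DecidableEq α] (S : Finset (Finset α)) : Prop :=
  ∀ A ∈ S, ∀ B ∈ S, A ≠ B → A ∩ B = kernel S

/-- `F` contains an `L`-sunflower with `m` petals. -/
def HasLSunflower {α : Type*} [DecidableEq α] (L : Finset ℕ) (m : ℕ)
    (F : Finset (Finset α)) : Prop :=
  ∃ S ⊆ F, S.card = m ∧ IsSunflower S ∧ (kernel S).card ∈ L

/-- `F` contains an `L`-clique of size `m`: a collection of `m` members of `F`, any two distinct
ones of which have intersection size in `L`. -/
def HasLClique {α : Type*} [DecidableEq α] (L : Finset ℕ) (m : ℕ)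
    (F : Finset (Finset α)) : Prop :=
  ∃ S ⊆ F, S.card = m ∧ ∀ A ∈ S, ∀ B ∈ S, A ≠ B → (A ∩ B).card ∈ L

/-- No two distinct members of `F` have intersection size in `L`. -/
def AvoidsIntersections {α : Type*} [DecidableEq α] (L : Finset ℕ)
    (F : Finset (Finset α)) : Prop :=
  ∀ A ∈ F, ∀ B ∈ F, A ≠ B → (A ∩ B).card ∉ L

/-! Lower bound. If `D` is smaller than `k` and is not the kernel of a sunflower with `m` petals,
then the union of a maximal sunflower with kernel `D` yields at most `k * m` points outside `D` that
meet every member containing `D` (`exists_cover`). All sizes below `a` lie in `L`, so a greedy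
choice of `a` cover points gives a star holding a fraction of order `m ^ (-a)` of the family
(`exists_large_star`). Inside the star, intersection sizes in `L` are at least `b`. Label points
randomly with `q = O(m)` labels. At least half of the star consists of sets `A` that are labelled
injectively and share no label with the cover points outside `A` of any `D ⊆ A` with size in `L`.
Colour the `k`-sets of labels with `O(q ^ (k - b))` colours so that distinct ones sharing at least
`b` labels differ, and keep the most popular colour. Two kept sets `A`, `B` meeting in a size in `L`
would have the same label set, yet a cover point of `A ∩ B` lying in `B \ A` has a label not used on
`A` (`exists_avoiding_of_cover`).

Tightness. Put `q = m - 1`. The factor `q ^ a` comes from the transversals of `a` blocks of size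
`q`: different transversals meet in fewer than `a` points, so an avoiding subfamily uses only one
(`IsTight.transversalJoin`). The factor `q ^ (k - b)` comes, after removing common points, from the
case `0 ∉ L`, `1 ∈ L`. There a rooted family grows one point at a time while avoiding subfamilies
keep at most one member at almost every root. If the current set size lies in `L`, add private
leaves (`IsRooted.leafFamily`); if not, add new roots, each joined to `q` disjoint copies
(`IsRooted.rootFamily`). -/

/-! ### Sunflowers, covers and large stars -/

/-- All pairwise intersections of distinct members of `S` are equal to `D`. -/
def PairwiseInter {α : Type*} [DecidableEq α] (D : Finset α) (S : Finset (Finset α)) : Prop :=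
  ∀ A ∈ S, ∀ B ∈ S, A ≠ B → A ∩ B = D

lemma PairwiseInter.mono {α : Type*} [DecidableEq α] {D : Finset α} {S T : Finset (Finset α)}
    (h : PairwiseInter D T) (hST : S ⊆ T) : PairwiseInter D S :=
  fun A hA B hB => h A (hST hA) B (hST hB)

lemma PairwiseInter.subset {α : Type*} [DecidableEq α] {D : Finset α} {S : Finset (Finset α)}
    (h : PairwiseInter D S) (hS : 2 ≤ S.card) {A : Finset α} (hA : A ∈ S) : D ⊆ A := by
  obtain ⟨B, hB, hBA⟩ := Finset.exists_mem_ne (s := S) (by omega) A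
  rw [← h A hA B hB hBA.symm]
  exact Finset.inter_subset_left

lemma PairwiseInter.kernel_eq {α : Type*} [DecidableEq α] {D : Finset α}
    {S : Finset (Finset α)} (h : PairwiseInter D S) (hS : 2 ≤ S.card) : kernel S = D := by
  obtain ⟨A, hA, B, hB, hAB⟩ := Finset.one_lt_card.mp hS
  ext x
  simp only [kernel, Finset.mem_filter, Finset.mem_biUnion, id]
  constructor
  · rintro ⟨-, hx⟩
    rw [← h A hA B hB hAB]
    exact Finset.mem_inter.mpr ⟨hx A hA, hx B hB⟩
  · intro hx
    exact ⟨⟨A, hA, h.subset hS hA hx⟩, fun C hC => h.subset hS hC hx⟩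

lemma hasLSunflower_iff {α : Type*} [DecidableEq α] {L : Finset ℕ} {m : ℕ} (hm : 2 ≤ m)
    {F : Finset (Finset α)} :
    HasLSunflower L m F ↔ ∃ S ⊆ F, S.card = m ∧ ∃ D, D.card ∈ L ∧ PairwiseInter D S := by
  constructor
  · rintro ⟨S, hS, hc, h, hL⟩
    exact ⟨S, hS, hc, kernel S, hL, h⟩
  · rintro ⟨S, hS, hc, D, hD, h⟩
    have hk := h.kernel_eq (by omega)
    refine ⟨S, hS, hc, ?_, by rwa [hk]⟩
    rw [IsSunflower, hk]
    exact h

lemma HasLSunflower.hasLClique {α : Type*} [DecidableEq α] {L : Finset ℕ} {m : ℕ}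
    {F : Finset (Finset α)} (h : HasLSunflower L m F) : HasLClique L m F := by
  obtain ⟨S, hS, hc, h, hL⟩ := h
  exact ⟨S, hS, hc, fun A hA B hB hAB => by rwa [h A hA B hB hAB]⟩

/-- If no `m` members of a `k`-uniform family pairwise meet exactly in `D`, then the members
containing `D` are covered, outside `D`, by few points. -/
lemma exists_cover {α : Type*} [DecidableEq α] {k m : ℕ} {F : Finset (Finset α)}
    (hF : IsUniform k F) {D : Finset α} (hD : D.card < k)
    (h : ∀ S ⊆ F, S.card = m → ¬ PairwiseInter D S) :
    ∃ X : Finset α, X.card ≤ k * m ∧ Disjoint X D ∧ ∀ B ∈ F, D ⊆ B → ∃ x ∈ X, x ∈ B := by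
  classical
  -- Take a maximal sunflower with kernel `D`. A member containing `D` that misses its union outside
  -- `D` could be added as a petal.
  obtain ⟨S, hS, hmax⟩ := Finset.exists_max_image
    (F.powerset.filter fun S => (∀ B ∈ S, D ⊆ B) ∧ PairwiseInter D S) Finset.card
    ⟨∅, Finset.mem_filter.mpr ⟨Finset.empty_mem_powerset _, by simp, fun A hA => absurd hA
      (Finset.notMem_empty A)⟩⟩
  simp only [Finset.mem_filter, Finset.mem_powerset] at hS hmax
  obtain ⟨hSF, hSD, hSp⟩ := hS
  have hcard : S.card ≤ m := by
    by_contra! hlt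
    obtain ⟨T, hT, hTc⟩ := Finset.exists_subset_card_eq hlt.le
    exact h T (hT.trans hSF) hTc (hSp.mono hT)
  refine ⟨S.biUnion id \ D, ?_, Finset.sdiff_disjoint, ?_⟩
  · calc _ ≤ (S.biUnion id).card := Finset.card_le_card Finset.sdiff_subset
      _ ≤ S.card * k := Finset.card_biUnion_le_card_mul _ _ _ fun A hA => (hF A (hSF hA)).le
      _ ≤ k * m := by rw [mul_comm]; gcongr
  · intro B hB hDB
    by_contra! hno
    have hBS : ∀ A ∈ S, A ∩ B = D := by
      intro A hA
      apply Finset.Subset.antisymm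
      · intro x hx
        rw [Finset.mem_inter] at hx
        by_contra hxD
        exact hno x (Finset.mem_sdiff.mpr ⟨Finset.mem_biUnion.mpr ⟨A, hA, hx.1⟩, hxD⟩) hx.2
      · exact Finset.subset_inter (hSD A hA) hDB
    have hBnot : B ∉ S := by
      intro hBS'
      have := hBS B hBS'
      rw [Finset.inter_self] at this
      rw [← this, hF B hB] at hD
      exact lt_irrefl _ hD
    have := hmax (insert B S) ⟨Finset.insert_subset hB hSF, by
      intro A hA
      rcases Finset.mem_insert.mp hA with rfl | hA
      · exact hDB
      · exact hSD A hA, by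
      intro A hA C hC hAC
      rcases Finset.mem_insert.mp hA with rfl | hA' <;>
        rcases Finset.mem_insert.mp hC with rfl | hC'
      · exact absurd rfl hAC
      · rw [Finset.inter_comm]; exact hBS C hC'
      · exact hBS A hA'
      · exact hSp A hA' C hC' hAC⟩
    rw [Finset.card_insert_of_notMem hBnot] at this
    omega

/-- If small sets are not kernels of large sunflowers, then some star on `i` points is large. -/
lemma exists_large_star {α : Type*} [DecidableEq α] {k m : ℕ} {F : Finset (Finset α)}
    (hF : IsUniform k F) (hne : F.Nonempty) (a : ℕ) (ha : a ≤ k)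
    (h : ∀ S ⊆ F, S.card = m → ∀ D : Finset α, D.card < a → ¬ PairwiseInter D S) :
    ∃ T : Finset α, T.card = a ∧
      F.card ≤ (k * m) ^ a * (F.filter fun A => T ⊆ A).card := by
  induction a with
  | zero => exact ⟨∅, by simp⟩
  | succ i ih =>
    obtain ⟨T, hT, hcard⟩ := ih (by omega) fun S hS hc D hD => h S hS hc D (by omega)
    obtain ⟨X, hX, hXT, hcov⟩ := exists_cover (m := m) hF (D := T) (by omega)
      fun S hS hc => h S hS hc T (by omega)
    have hFT : (F.filter fun A => T ⊆ A).Nonempty := by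
      rw [← Finset.card_pos]
      by_contra h0
      have : (F.filter fun A => T ⊆ A).card = 0 := by omega
      rw [this, mul_zero] at hcard
      exact absurd hne.card_pos (by omega)
    obtain ⟨A, hA⟩ := hFT
    rw [Finset.mem_filter] at hA
    obtain ⟨x₀, hx₀, -⟩ := hcov A hA.1 hA.2
    -- The star on `T` is covered by the stars on `insert x T` with `x ∈ X`; the most popular `x`
    -- loses a factor of at most `k * m`.
    obtain ⟨x, hx, hmax⟩ := Finset.exists_max_image X
      (fun x => (F.filter fun A => insert x T ⊆ A).card) ⟨x₀, hx₀⟩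
    refine ⟨insert x T, ?_, ?_⟩
    · rw [Finset.card_insert_of_notMem (Finset.disjoint_left.mp hXT hx), hT]
    · have hle : (F.filter fun A => T ⊆ A).card ≤
          k * m * (F.filter fun A => insert x T ⊆ A).card := by
        calc _ ≤ (X.biUnion fun x => F.filter fun A => insert x T ⊆ A).card := by
              apply Finset.card_le_card
              intro B hB
              rw [Finset.mem_filter] at hB
              obtain ⟨y, hy, hyB⟩ := hcov B hB.1 hB.2
              exact Finset.mem_biUnion.mpr ⟨y, hy, Finset.mem_filter.mpr
                ⟨hB.1, Finset.insert_subset hyB hB.2⟩⟩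
          _ ≤ X.card * _ := Finset.card_biUnion_le_card_mul _ _ _ hmax
          _ ≤ _ := by gcongr
      calc _ ≤ _ := hcard
        _ ≤ (k * m) ^ i * (k * m * (F.filter fun A => insert x T ⊆ A).card) := by gcongr
        _ = _ := by ring

/-! ### Random labellings and colourings -/

/-- If `g x = g y`, overwriting the value at `x` loses nothing, since it can be read off at `y`. So
each such `g` yields `q` labellings, all of them distinct. -/
lemma card_filter_apply_eq_mul_le {V : Type*} [Fintype V] [DecidableEq V] (q : ℕ) {x y : V}
    (hxy : x ≠ y) :
    (Finset.univ.filter fun g : V → Fin q => g x = g y).card * q ≤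
      Fintype.card (V → Fin q) := by
  have : (((Finset.univ.filter fun g : V → Fin q => g x = g y) ×ˢ
      (Finset.univ : Finset (Fin q)))).card ≤ (Finset.univ : Finset (V → Fin q)).card := by
    refine Finset.card_le_card_of_injOn (fun p => Function.update p.1 x p.2)
      (fun _ _ => Finset.mem_coe.mpr (Finset.mem_univ _)) ?_
    rintro ⟨g, c⟩ hg ⟨g', c'⟩ hg' h
    simp only [Finset.coe_product, Finset.coe_filter, Finset.mem_univ, true_and, Set.mem_prod,
      Set.mem_ofPred_eq, Finset.coe_univ, Set.mem_univ, and_true] at hg hg' h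
    have hne : ∀ z, z ≠ x → g z = g' z := by
      intro z hz
      have := congrFun h z
      simpa [Function.update_of_ne hz] using this
    have hc : c = c' := by simpa using congrFun h x
    have : g = g' := by
      funext z
      by_cases hz : z = x
      · rw [hz, hg, hg', hne y hxy.symm]
      · exact hne z hz
    rw [this, hc]
  simpa using this

/-- A random labelling separates, for at least half of the indices, all prescribed pairs. -/
lemma exists_separating_labelling {α ι : Type*} [DecidableEq α] (s : Finset ι)
    (P : ι → Finset (α × α)) (hP : ∀ i ∈ s, ∀ p ∈ P i, p.1 ≠ p.2) {N q : ℕ}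
    (hN : ∀ i ∈ s, (P i).card ≤ N) (hq : 2 * N ≤ q) (hq0 : 0 < q) :
    ∃ f : α → Fin q, s.card ≤ 2 * (s.filter fun i => ∀ p ∈ P i, f p.1 ≠ f p.2).card := by
  classical
  set V : Finset α := s.biUnion fun i => (P i).image Prod.fst ∪ (P i).image Prod.snd with hV
  have hmem : ∀ i ∈ s, ∀ p ∈ P i, p.1 ∈ V ∧ p.2 ∈ V := by
    intro i hi p hp
    constructor
    · exact Finset.mem_biUnion.mpr ⟨i, hi, Finset.mem_union_left _ (Finset.mem_image_of_mem _ hp)⟩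
    · exact Finset.mem_biUnion.mpr ⟨i, hi, Finset.mem_union_right _ (Finset.mem_image_of_mem _ hp)⟩
  -- Only the labels on the finite set `V` of points that occur are random; the default label `0`
  -- elsewhere plays no role.
  let e : (V → Fin q) → α → Fin q := fun g x => if h : x ∈ V then g ⟨x, h⟩ else ⟨0, hq0⟩
  have he : ∀ g x (hx : x ∈ V), e g x = g ⟨x, hx⟩ := fun g x hx => by simp [e, hx]
  set Ω := Fintype.card (V → Fin q) with hΩ
  have hΩpos : 0 < Ω := by
    have : Nonempty (Fin q) := ⟨⟨0, hq0⟩⟩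
    exact Fintype.card_pos
  have hbad : ∀ i ∈ s, 2 * (Finset.univ.filter fun g : V → Fin q =>
      ∃ p ∈ P i, e g p.1 = e g p.2).card ≤ Ω := by
    intro i hi
    have h1 : (Finset.univ.filter fun g : V → Fin q => ∃ p ∈ P i, e g p.1 = e g p.2).card * q ≤
        N * Ω := by
      calc _ ≤ (∑ p ∈ P i, (Finset.univ.filter fun g : V → Fin q =>
              e g p.1 = e g p.2).card) * q := by
            gcongr
            refine (Finset.card_le_card ?_).trans Finset.card_biUnion_le
            intro g hg
            simpa using hg
        _ = ∑ p ∈ P i, (Finset.univ.filter fun g : V → Fin q =>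
              e g p.1 = e g p.2).card * q := Finset.sum_mul _ _ _
        _ ≤ ∑ p ∈ P i, Ω := by
            refine Finset.sum_le_sum fun p hp => ?_
            obtain ⟨h1, h2⟩ := hmem i hi p hp
            simp only [he _ _ h1, he _ _ h2]
            exact card_filter_apply_eq_mul_le q
              (fun h => hP i hi p hp (Subtype.ext_iff.mp h))
        _ = (P i).card * Ω := by simp
        _ ≤ N * Ω := by gcongr; exact hN i hi
    refine Nat.le_of_mul_le_mul_right (c := q) ?_ hq0
    calc _ = 2 * ((Finset.univ.filter fun g : V → Fin q =>
            ∃ p ∈ P i, e g p.1 = e g p.2).card * q) := by ring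
      _ ≤ 2 * (N * Ω) := by gcongr
      _ = (2 * N) * Ω := by ring
      _ ≤ q * Ω := by gcongr
      _ = Ω * q := mul_comm _ _
  -- Double counting: if every labelling failed for more than half of the indices, some index would
  -- fail for more than half of the labellings, against `hbad`.
  by_contra! hcon
  have hlt : ∀ g : V → Fin q, s.card + 1 ≤
      2 * (s.filter fun i => ∃ p ∈ P i, e g p.1 = e g p.2).card := by
    intro g
    have h1 := hcon (e g)
    have h2 := Finset.card_filter_add_card_filter_not (s := s)
      (fun i => ∀ p ∈ P i, e g p.1 ≠ e g p.2)
    simp only [not_forall, not_not, exists_prop] at h2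
    omega
  have hsum := Finset.sum_le_sum fun g (_ : g ∈ (Finset.univ : Finset (V → Fin q))) => hlt g
  have hswap : ∑ g : V → Fin q, 2 * (s.filter fun i => ∃ p ∈ P i, e g p.1 = e g p.2).card =
      ∑ i ∈ s, 2 * (Finset.univ.filter fun g : V → Fin q =>
        ∃ p ∈ P i, e g p.1 = e g p.2).card := by
    rw [← Finset.mul_sum, ← Finset.mul_sum]
    congr 1
    simp only [Finset.card_filter]
    exact Finset.sum_comm
  rw [hswap] at hsum
  have := hsum.trans (Finset.sum_le_sum hbad)
  simp only [Finset.sum_const, Finset.card_univ, smul_eq_mul, ← hΩ] at this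
  nlinarith

/-- Greedy colouring of a finite graph. -/
lemma exists_coloring_of_degree_le {V : Type*} [DecidableEq V] (r : V → V → Prop)
    [DecidableRel r] (hr : ∀ x y, r x y → r y x) {N : ℕ} (s : Finset V)
    (hdeg : ∀ x ∈ s, (s.filter fun y => r x y).card ≤ N) :
    ∃ c : V → Fin (N + 1), ∀ x ∈ s, ∀ y ∈ s, x ≠ y → r x y → c x ≠ c y := by
  induction s using Finset.induction_on with
  | empty => exact ⟨fun _ => 0, by simp⟩
  | insert v s hv ih =>
    obtain ⟨c, hc⟩ := ih fun x hx => le_trans (Finset.card_le_card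
      (Finset.filter_subset_filter _ (Finset.subset_insert _ _)))
      (hdeg x (Finset.mem_insert_of_mem hx))
    have hlt : ((s.filter fun y => r v y).image c).card <
        (Finset.univ : Finset (Fin (N + 1))).card := by
      rw [Finset.card_univ, Fintype.card_fin]
      refine Nat.lt_succ_of_le (Finset.card_image_le.trans (le_trans (Finset.card_le_card
        (Finset.filter_subset_filter _ (Finset.subset_insert _ _)))
        (hdeg v (Finset.mem_insert_self _ _))))
    obtain ⟨d, -, hd⟩ := Finset.exists_mem_notMem_of_card_lt_card hlt
    have hd' : ∀ y ∈ s, r v y → c y ≠ d := fun y hy hvy h =>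
      hd (Finset.mem_image.mpr ⟨y, Finset.mem_filter.mpr ⟨hy, hvy⟩, h⟩)
    have hne : ∀ y ∈ s, y ≠ v := fun y hy h => hv (h ▸ hy)
    refine ⟨Function.update c v d, fun x hx y hy hxy hrxy => ?_⟩
    rcases Finset.mem_insert.mp hx with rfl | hx' <;>
      rcases Finset.mem_insert.mp hy with rfl | hy'
    · exact absurd rfl hxy
    · rw [Function.update_self, Function.update_of_ne (hne y hy')]
      exact (hd' y hy' hrxy).symm
    · rw [Function.update_self, Function.update_of_ne (hne x hx')]
      exact hd' x hx' (hr _ _ hrxy)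
    · rw [Function.update_of_ne (hne x hx'), Function.update_of_ne (hne y hy')]
      exact hc x hx' y hy' hxy hrxy

/-- Few colours suffice to separate any two distinct `k`-subsets of `Fin q` that share `b`
points. -/
lemma exists_coloring_of_card_inter (q k b : ℕ) :
    ∃ c : Finset (Fin q) → Fin (2 ^ k * q ^ (k - b) + 1), ∀ S T : Finset (Fin q),
      S.card = k → T.card = k → S ≠ T → b ≤ (S ∩ T).card → c S ≠ c T := by
  obtain ⟨c, hc⟩ := exists_coloring_of_degree_le (N := 2 ^ k * q ^ (k - b))
    (fun S T : Finset (Fin q) => b ≤ (S ∩ T).card)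
    (fun S T h => by rwa [Finset.inter_comm]) (Finset.powersetCard k Finset.univ) (by
      intro S hS
      rw [Finset.mem_powersetCard_univ] at hS
      -- Degree bound: a neighbour `T` of `S` is the union of a `b`-subset `R` of `S ∩ T` and the
      -- `(k - b)`-set `T \ R`.
      calc _ ≤ (((Finset.powersetCard b S) ×ˢ
              (Finset.powersetCard (k - b) (Finset.univ : Finset (Fin q)))).image
              fun p => p.1 ∪ p.2).card := by
            apply Finset.card_le_card
            intro T hT
            rw [Finset.mem_filter, Finset.mem_powersetCard_univ] at hT
            obtain ⟨R, hR, hRc⟩ := Finset.exists_subset_card_eq hT.2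
            have hRT := hR.trans Finset.inter_subset_right
            refine Finset.mem_image.mpr ⟨(R, T \ R), ?_, Finset.union_sdiff_of_subset hRT⟩
            simp only [Finset.mem_product, Finset.mem_powersetCard, Finset.subset_univ, true_and]
            exact ⟨⟨hR.trans Finset.inter_subset_left, hRc⟩, by
              rw [Finset.card_sdiff_of_subset hRT, hT.1, hRc]⟩
        _ ≤ _ := Finset.card_image_le
        _ = k.choose b * q.choose (k - b) := by
            rw [Finset.card_product, Finset.card_powersetCard, Finset.card_powersetCard, hS,
              Finset.card_univ, Fintype.card_fin]
        _ ≤ _ := Nat.mul_le_mul (Nat.choose_le_two_pow _ _) (Nat.choose_le_pow _ _))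
  exact ⟨c, fun S T hS hT hST h => hc S (Finset.mem_powersetCard_univ.mpr hS) T
    (Finset.mem_powersetCard_univ.mpr hT) hST h⟩

lemma exists_card_le_mul_card_fiber {ι : Type*} (s : Finset ι) {n : ℕ} (c : ι → Fin (n + 1)) :
    ∃ d, s.card ≤ (n + 1) * (s.filter fun i => c i = d).card := by
  obtain ⟨d, -, hd⟩ := Finset.exists_max_image Finset.univ
    (fun d => (s.filter fun i => c i = d).card) ⟨0, Finset.mem_univ _⟩
  refine ⟨d, ?_⟩
  have := Finset.card_le_mul_card_image_of_maps_to (s := s) (t := Finset.univ) (f := c)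
    (fun _ _ => Finset.mem_univ _) _ hd
  rwa [Finset.card_univ, Fintype.card_fin, mul_comm] at this

/-! ### Proof of the lower bound -/

/-- A star without sunflowers whose kernel size lies in `L` has a large subfamily avoiding
intersection sizes in `L`. -/
lemma exists_avoiding_of_cover {α : Type*} [DecidableEq α] {k m b : ℕ} (hk : 1 ≤ k) (hm : 1 ≤ m)
    {L : Finset ℕ} (hL : L ⊆ Finset.range k) {G : Finset (Finset α)}
    (hG : IsUniform k G)
    (hinter : ∀ A ∈ G, ∀ B ∈ G, (A ∩ B).card ∈ L → b ≤ (A ∩ B).card)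
    (h : ∀ S ⊆ G, S.card = m → ∀ D : Finset α, D.card ∈ L → ¬ PairwiseInter D S) :
    ∃ F' ⊆ G, AvoidsIntersections L F' ∧
      G.card ≤ 2 * (2 ^ k * (2 * ((2 ^ k + 1) * k ^ 2 * m)) ^ (k - b) + 1) * F'.card := by
  classical
  have hX : ∀ D : Finset α, ∃ X : Finset α, X.card ≤ k * m ∧
      (D.card ∈ L → Disjoint X D ∧ ∀ B ∈ G, D ⊆ B → ∃ x ∈ X, x ∈ B) := by
    intro D
    by_cases hD : D.card ∈ L
    · obtain ⟨X, h1, h2⟩ := exists_cover hG (Finset.mem_range.mp (hL hD))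
        fun S hS hc => h S hS hc D hD
      exact ⟨X, h1, fun _ => h2⟩
    · exact ⟨∅, by simp, fun h => absurd h hD⟩
  choose X hXc hX using hX
  -- The first pairs force injectivity on `A`; the others separate `A` from the cover points of
  -- every possible intersection `D ⊆ A`. Together they number at most `k ^ 2 * m + 2 ^ k * (k * m *
  -- k)`.
  let P : Finset α → Finset (α × α) := fun A =>
    A.offDiag ∪ A.powerset.biUnion fun D => (X D \ A) ×ˢ A
  obtain ⟨f, hf⟩ := exists_separating_labelling G P (N := (2 ^ k + 1) * k ^ 2 * m)
    (q := 2 * ((2 ^ k + 1) * k ^ 2 * m)) (by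
      intro A _ p hp
      rcases Finset.mem_union.mp hp with hp | hp
      · exact (Finset.mem_offDiag.mp hp).2.2
      · obtain ⟨D, -, hp⟩ := Finset.mem_biUnion.mp hp
        rw [Finset.mem_product, Finset.mem_sdiff] at hp
        exact fun h => hp.1.2 (h ▸ hp.2)) (by
      intro A hA
      have hAc := hG A hA
      calc (P A).card ≤ A.offDiag.card + (A.powerset.biUnion fun D => (X D \ A) ×ˢ A).card :=
            Finset.card_union_le _ _
        _ ≤ k ^ 2 * m + 2 ^ k * (k * m * k) := by
            gcongr
            · rw [Finset.offDiag_card, hAc]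
              calc k * k - k ≤ k * k := Nat.sub_le _ _
                _ = k ^ 2 * 1 := by ring
                _ ≤ _ := by gcongr
            · refine (Finset.card_biUnion_le_card_mul _ _ (k * m * k) fun D _ => ?_).trans ?_
              · rw [Finset.card_product, hAc]
                gcongr
                exact (Finset.card_le_card Finset.sdiff_subset).trans (hXc D)
              · rw [Finset.card_powerset, hAc]
        _ = _ := by ring) le_rfl (by positivity)
  set G₁ := G.filter fun i => ∀ p ∈ P i, f p.1 ≠ f p.2 with hG₁
  have hinj : ∀ A ∈ G₁, Set.InjOn f A := by
    intro A hA x hx y hy hxy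
    by_contra hne
    exact (Finset.mem_filter.mp hA).2 (x, y)
      (Finset.mem_union_left _ (Finset.mem_offDiag.mpr ⟨hx, hy, hne⟩)) hxy
  obtain ⟨c, hc⟩ := exists_coloring_of_card_inter (2 * ((2 ^ k + 1) * k ^ 2 * m)) k b
  obtain ⟨d, hd⟩ := exists_card_le_mul_card_fiber G₁ fun A => c (A.image f)
  refine ⟨G₁.filter fun A => c (A.image f) = d,
    (Finset.filter_subset _ _).trans (Finset.filter_subset _ _), ?_, ?_⟩
  · intro A hA B hB hAB hAL
    rw [Finset.mem_filter] at hA hB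
    have hAG := (Finset.mem_filter.mp hA.1)
    have hBG := (Finset.mem_filter.mp hB.1)
    have himg : A.image f = B.image f := by
      by_contra hne
      refine hc _ _ ?_ ?_ hne ?_ (hA.2.trans hB.2.symm)
      · rw [Finset.card_image_of_injOn (hinj A hA.1), hG A hAG.1]
      · rw [Finset.card_image_of_injOn (hinj B hB.1), hG B hBG.1]
      · calc b ≤ (A ∩ B).card := hinter A hAG.1 B hBG.1 hAL
          _ = ((A ∩ B).image f).card := (Finset.card_image_of_injOn
              ((hinj A hA.1).mono (by simp))).symm
          _ ≤ _ := Finset.card_le_card (Finset.image_inter_subset _ _ _)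
    -- The cover point `x` of `A ∩ B` found in `B` lies outside `A`, but its label occurs on `A`
    -- because the label sets coincide.
    obtain ⟨hdisj, hcov⟩ := hX _ hAL
    obtain ⟨x, hx, hxB⟩ := hcov B hBG.1 Finset.inter_subset_right
    have hxA : x ∉ A := fun hxA =>
      Finset.disjoint_left.mp hdisj hx (Finset.mem_inter.mpr ⟨hxA, hxB⟩)
    obtain ⟨a, ha, hfa⟩ := Finset.mem_image.mp (himg ▸ Finset.mem_image_of_mem f hxB)
    refine hAG.2 (x, a) (Finset.mem_union_right _ (Finset.mem_biUnion.mpr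
      ⟨A ∩ B, Finset.mem_powerset.mpr Finset.inter_subset_left, ?_⟩)) hfa.symm
    exact Finset.mem_product.mpr ⟨Finset.mem_sdiff.mpr ⟨hx, hxA⟩, ha⟩
  · calc G.card ≤ 2 * G₁.card := hf
      _ ≤ 2 * (_ * _) := Nat.mul_le_mul_left _ hd
      _ = _ := by ring

/-- The lower bound with explicit constants. -/
lemma exists_large_avoiding {α : Type*} [DecidableEq α] {k m a b : ℕ} (hk : 1 ≤ k) (hm : 1 ≤ m)
    (hab : a ≤ b) (hb : b ≤ k) {L : Finset ℕ} (hL : L ⊆ Finset.range k)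
    (hLa : ∀ i < a, i ∈ L) (hLb : ∀ i, a ≤ i → i ∈ L → b ≤ i)
    {F : Finset (Finset α)} (hF : IsUniform k F)
    (h : ∀ S ⊆ F, S.card = m → ∀ D : Finset α, D.card ∈ L → ¬ PairwiseInter D S) :
    ∃ F' ⊆ F, AvoidsIntersections L F' ∧
      F.card ≤ (k ^ k * 2 ^ (k + 2) * (2 * ((2 ^ k + 1) * k ^ 2)) ^ k) * m ^ (k - b + a) *
        F'.card := by
  rcases F.eq_empty_or_nonempty with rfl | hne
  · exact ⟨∅, by simp, by simp [AvoidsIntersections], by simp⟩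
  obtain ⟨T, hT, hcard⟩ := exists_large_star (m := m) hF hne a (hab.trans hb)
    fun S hS hc D hD => h S hS hc D (hLa _ hD)
  obtain ⟨F', hF', havoid, hle⟩ := exists_avoiding_of_cover (b := b)
    (G := F.filter fun A => T ⊆ A) hk hm hL (fun A hA => hF A (Finset.mem_filter.mp hA).1)
    (fun A hA B hB hAB => hLb _ (by
      rw [← hT]
      exact Finset.card_le_card (Finset.subset_inter (Finset.mem_filter.mp hA).2
        (Finset.mem_filter.mp hB).2)) hAB)
    (fun S hS => h S (hS.trans (Finset.filter_subset _ _)))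
  refine ⟨F', hF'.trans (Finset.filter_subset _ _), havoid, ?_⟩
  set Q := 2 * ((2 ^ k + 1) * k ^ 2) with hQ
  have hQpos : 1 ≤ Q := by rw [hQ]; exact Nat.one_le_iff_ne_zero.mpr (by positivity)
  have hQm : 2 * ((2 ^ k + 1) * k ^ 2 * m) = Q * m := by rw [hQ]; ring
  rw [hQm] at hle
  calc F.card ≤ (k * m) ^ a * (2 * (2 ^ k * (Q * m) ^ (k - b) + 1) * F'.card) :=
        hcard.trans (Nat.mul_le_mul_left _ hle)
    -- Exponents of `k` and `Q` are raised to `k` to make the constant independent of `a` and `b`,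
    -- and the extra colour `1` is absorbed by doubling.
    _ ≤ (k ^ k * m ^ a) * (2 * (2 ^ k * (Q ^ k * m ^ (k - b)) +
          2 ^ k * (Q ^ k * m ^ (k - b))) * F'.card) := by
        rw [mul_pow, mul_pow]
        have h1 : k ^ a ≤ k ^ k := Nat.pow_le_pow_right hk (hab.trans hb)
        have h2 : Q ^ (k - b) ≤ Q ^ k := Nat.pow_le_pow_right hQpos (Nat.sub_le _ _)
        have h3 : 1 ≤ 2 ^ k * (Q ^ k * m ^ (k - b)) :=
          Nat.one_le_iff_ne_zero.mpr (by positivity)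
        gcongr
    _ = _ := by rw [pow_add, pow_add]; ring

/-! ### Tight families and transversals -/

lemma disjSum_inter_disjSum {α β : Type*} [DecidableEq α] [DecidableEq β] (s s' : Finset α)
    (t t' : Finset β) : s.disjSum t ∩ s'.disjSum t' = (s ∩ s').disjSum (t ∩ t') := by
  ext (x | x) <;> simp

lemma singleton_product_injective {α β : Type*} (j : α) :
    Function.Injective fun A : Finset β => ({j} : Finset α) ×ˢ A := by
  intro A B h
  ext x
  have := congrArg (fun s => (j, x) ∈ s) h
  simpa using this

/-- A `k`-uniform family without `L`-sunflowers with `q + 1` petals, all of whose `L`-avoiding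
subfamilies have density at most `2 / q ^ e`. -/
structure IsTight {α : Type*} [DecidableEq α] (k q e : ℕ) (L : Finset ℕ)
    (F : Finset (Finset α)) : Prop where
  nonempty : F.Nonempty
  uniform : IsUniform k F
  no_sunflower : ∀ S ⊆ F, S.card = q + 1 → ∀ D : Finset α, D.card ∈ L → ¬ PairwiseInter D S
  avoid : ∀ F' ⊆ F, AvoidsIntersections L F' → F'.card * q ^ e ≤ 2 * F.card

/-- An injection that respects intersections and shifts all sizes by `c` carries sunflowers and
avoiding families back and forth. As a sunflower here has at least two petals, its kernel is an
intersection and so lies in the range of `Φ`. -/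
lemma IsTight.image {α β : Type*} [DecidableEq α] [DecidableEq β] {k q e c : ℕ}
    {L' L : Finset ℕ} {H : Finset (Finset α)} (hH : IsTight k q e L' H) (hq : 1 ≤ q)
    (hL : ∀ l, l + c ∈ L → l ∈ L') (hL' : ∀ l ∈ L', l + c ∈ L) (Φ : Finset α → Finset β)
    (hΦ : Function.Injective Φ)
    (hinter : ∀ A B, Φ A ∩ Φ B = Φ (A ∩ B)) (hcard : ∀ A, (Φ A).card = A.card + c) :
    IsTight (k + c) q e L (H.image Φ) := by
  have hpre : ∀ S ⊆ H.image Φ, ∃ T ⊆ H, S = T.image Φ ∧ T.card = S.card := by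
    intro S hS
    obtain ⟨T, hT, rfl⟩ := Finset.subset_image_iff.mp hS
    exact ⟨T, hT, rfl, (Finset.card_image_of_injective _ hΦ).symm⟩
  refine ⟨hH.nonempty.image _, ?_, ?_, ?_⟩
  · intro B hB
    obtain ⟨A, hA, rfl⟩ := Finset.mem_image.mp hB
    rw [hcard, hH.uniform A hA]
  · intro S hS hSc D hD h
    obtain ⟨T, hT, rfl, hTc⟩ := hpre S hS
    obtain ⟨A, hA, B, hB, hAB⟩ := Finset.one_lt_card.mp (by omega : 1 < T.card)
    have hPhi : ∀ A ∈ T, ∀ B ∈ T, A ≠ B → Φ (A ∩ B) = D := fun A hA B hB hAB => by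
      rw [← hinter]
      exact h _ (Finset.mem_image_of_mem _ hA) _ (Finset.mem_image_of_mem _ hB) (hΦ.ne hAB)
    have h0 := hPhi A hA B hB hAB
    refine hH.no_sunflower T hT (by omega) (A ∩ B) (hL _ ?_)
      fun A' hA' B' hB' hAB' => hΦ ((hPhi A' hA' B' hB' hAB').trans h0.symm)
    rwa [← hcard, h0]
  · intro F' hF' h
    obtain ⟨T, hT, rfl, hTc⟩ := hpre F' hF'
    rw [← hTc, Finset.card_image_of_injective _ hΦ]
    refine hH.avoid T hT fun A hA B hB hAB hL0 => ?_
    refine h _ (Finset.mem_image_of_mem _ hA) _ (Finset.mem_image_of_mem _ hB) (hΦ.ne hAB) ?_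
    rw [hinter, hcard]
    exact hL' _ hL0

/-- Adding `c` common points to all members. -/
lemma IsTight.add_common {α : Type*} [DecidableEq α] {k q e c : ℕ}
    {L' L : Finset ℕ} {H : Finset (Finset α)} (hH : IsTight k q e L' H) (hq : 1 ≤ q)
    (hL : ∀ l, l + c ∈ L ↔ l ∈ L') :
    IsTight (k + c) q e L
      (H.image fun A => A.disjSum (Finset.univ : Finset (Fin c))) := by
  refine hH.image hq (fun l => (hL l).mp) (fun l => (hL l).mpr) _ ?_ ?_ ?_
  · intro A B h
    simpa using congrArg Finset.toLeft h
  · intro A B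
    rw [disjSum_inter_disjSum, Finset.inter_self]
  · intro A
    simp

lemma IsTight.map {α β : Type*} [DecidableEq α] [DecidableEq β] {k q e : ℕ}
    {L : Finset ℕ} {H : Finset (Finset α)} (hH : IsTight k q e L H) (hq : 1 ≤ q) (f : α ↪ β) :
    IsTight k q e L (H.image fun A => A.map f) :=
  hH.image (c := 0) hq (fun _ => id) (fun _ => id) _ (Finset.map_injective f)
    (fun A B => (Finset.map_inter _ _).symm) (fun A => by simp)

/-- The transversal `t` of `a` blocks of size `q`, together with a copy of `A` tagged with `t`. -/
def transversalJoin {α : Type*} {a q : ℕ} (t : Fin a → Fin q) (A : Finset α) :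
    Finset ((Fin a × Fin q) ⊕ ((Fin a → Fin q) × α)) :=
  (Finset.univ.map ⟨fun i => (i, t i), fun _ _ h => congrArg Prod.fst h⟩).disjSum ({t} ×ˢ A)

section transversalJoin

variable {α : Type*} {a q : ℕ}

lemma inl_mem_transversalJoin {t : Fin a → Fin q} {A : Finset α} {i : Fin a} {y : Fin q} :
    Sum.inl (i, y) ∈ transversalJoin t A ↔ t i = y := by
  simp only [transversalJoin, Finset.inl_mem_disjSum, Finset.mem_map, Finset.mem_univ, true_and]
  constructor
  · rintro ⟨j, h⟩
    obtain ⟨rfl, rfl⟩ := Prod.ext_iff.mp h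
    rfl
  · rintro rfl
    exact ⟨i, rfl⟩

lemma inr_mem_transversalJoin {t s : Fin a → Fin q} {A : Finset α} {x : α} :
    Sum.inr (s, x) ∈ transversalJoin t A ↔ s = t ∧ x ∈ A := by
  simp [transversalJoin, and_comm, eq_comm]

lemma card_transversalJoin (t : Fin a → Fin q) (A : Finset α) :
    (transversalJoin t A).card = A.card + a := by
  simp [transversalJoin, add_comm]

lemma transversalJoin_injective {t t' : Fin a → Fin q} {A A' : Finset α}
    (h : transversalJoin t A = transversalJoin t' A') : t = t' ∧ A = A' := by
  have ht : t = t' := by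
    funext i
    have : Sum.inl (i, t i) ∈ transversalJoin t' A' := h ▸ inl_mem_transversalJoin.mpr rfl
    exact (inl_mem_transversalJoin.mp this).symm
  subst ht
  refine ⟨rfl, singleton_product_injective t ?_⟩
  simpa [transversalJoin] using congrArg Finset.toRight h

lemma transversalJoin_inter [DecidableEq α] (t : Fin a → Fin q) (A B : Finset α) :
    transversalJoin t A ∩ transversalJoin t B = transversalJoin t (A ∩ B) := by
  ext (⟨i, y⟩ | ⟨s, x⟩)
  · simp [inl_mem_transversalJoin]
  · simp only [Finset.mem_inter, inr_mem_transversalJoin]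
    tauto

/-- The tags make the second parts disjoint, and the block where `t` and `t'` differ contributes
nothing. -/
lemma card_transversalJoin_inter_lt [DecidableEq α] {t t' : Fin a → Fin q} (h : t ≠ t')
    (A B : Finset α) : (transversalJoin t A ∩ transversalJoin t' B).card < a := by
  obtain ⟨i, hi⟩ := Function.ne_iff.mp h
  calc _ ≤ ((Finset.univ.erase i).image fun i =>
        (Sum.inl (i, t i) : (Fin a × Fin q) ⊕ ((Fin a → Fin q) × α))).card := by
        apply Finset.card_le_card
        rintro (⟨j, y⟩ | ⟨s, x⟩) hx
        · rw [Finset.mem_inter, inl_mem_transversalJoin, inl_mem_transversalJoin] at hx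
          refine Finset.mem_image.mpr ⟨j, Finset.mem_erase.mpr ⟨?_, Finset.mem_univ _⟩, ?_⟩
          · rintro rfl
            exact hi (hx.1.trans hx.2.symm)
          · rw [hx.1]
        · rw [Finset.mem_inter, inr_mem_transversalJoin, inr_mem_transversalJoin] at hx
          exact absurd (hx.1.1.symm.trans hx.2.1) h
    _ ≤ _ := Finset.card_image_le
    _ < (Finset.univ : Finset (Fin a)).card :=
        Finset.card_erase_lt_of_mem (Finset.mem_univ i)
    _ = a := by simp

end transversalJoin

/-- If two petals have different transversals, the kernel misses some block, so all petals use
different points of that block and there are at most `q` of them. Otherwise the sunflower lives in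
one copy of `H`. An avoiding subfamily also lives in one copy, because sizes below `a` lie in `L`;
this gains the factor `q ^ a`. -/
lemma IsTight.transversalJoin {α : Type*} [DecidableEq α] {k q e a : ℕ}
    {L' L : Finset ℕ} {H : Finset (Finset α)} (hH : IsTight k q e L' H) (hq : 1 ≤ q)
    (hL : ∀ l, l + a ∈ L ↔ l ∈ L') (ha : ∀ i < a, i ∈ L) :
    IsTight (k + a) q (e + a) L
      (((Finset.univ : Finset (Fin a → Fin q)) ×ˢ H).image fun p =>
        _root_.transversalJoin p.1 p.2) := by
  set F := ((Finset.univ : Finset (Fin a → Fin q)) ×ˢ H).image fun p =>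
        _root_.transversalJoin p.1 p.2 with hF
  have hmem : ∀ X ∈ F, ∃ t, ∃ A ∈ H, X = _root_.transversalJoin t A := by
    intro X hX
    obtain ⟨⟨t, A⟩, hA, rfl⟩ := Finset.mem_image.mp hX
    exact ⟨t, A, (Finset.mem_product.mp hA).2, rfl⟩
  have hfix : ∀ S ⊆ F, ∀ t, (∀ X ∈ S, ∃ A ∈ H, X = _root_.transversalJoin t A) →
      ∃ T ⊆ H, S = T.image (_root_.transversalJoin t) ∧ T.card = S.card := by
    intro S hS t hSt
    have : S ⊆ H.image (_root_.transversalJoin t) := fun X hX => by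
      obtain ⟨A, hA, rfl⟩ := hSt X hX
      exact Finset.mem_image_of_mem _ hA
    obtain ⟨T, hT, rfl⟩ := Finset.subset_image_iff.mp this
    exact ⟨T, hT, rfl, (Finset.card_image_of_injective _
      fun A B h => (transversalJoin_injective h).2).symm⟩
  have hinj : ∀ t, Function.Injective (_root_.transversalJoin t : Finset α → _) :=
    fun t A B h => (transversalJoin_injective (a := a) (q := q) h).2
  refine ⟨?_, ?_, ?_, ?_⟩
  · refine Finset.Nonempty.image (Finset.Nonempty.product ⟨fun _ => ⟨0, hq⟩, ?_⟩ hH.nonempty) _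
    exact Finset.mem_univ _
  · intro X hX
    obtain ⟨t, A, hA, rfl⟩ := hmem X hX
    rw [card_transversalJoin, hH.uniform A hA]
  · intro S hS hSc D hD h
    obtain ⟨X₀, hX₀⟩ : S.Nonempty := Finset.card_pos.mp (by omega)
    obtain ⟨t, A₀, hA₀, rfl⟩ := hmem X₀ (hS hX₀)
    by_cases hall : ∀ X ∈ S, ∃ A ∈ H, X = _root_.transversalJoin t A
    · obtain ⟨T, hT, rfl, hTc⟩ := hfix S hS t hall
      obtain ⟨A, hA, B, hB, hAB⟩ := Finset.one_lt_card.mp (by omega : 1 < T.card)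
      have hPhi : ∀ A ∈ T, ∀ B ∈ T, A ≠ B → _root_.transversalJoin t (A ∩ B) = D :=
        fun A hA B hB hAB => by
          rw [← transversalJoin_inter]
          exact h _ (Finset.mem_image_of_mem _ hA) _ (Finset.mem_image_of_mem _ hB)
            ((hinj t).ne hAB)
      have h0 := hPhi A hA B hB hAB
      refine hH.no_sunflower T hT (by omega) (A ∩ B) ((hL _).mp ?_)
        fun A' hA' B' hB' hAB' => hinj t ((hPhi A' hA' B' hB' hAB').trans h0.symm)
      rwa [← card_transversalJoin t, h0]
    · push Not at hall
      obtain ⟨X, hX, hXt⟩ := hall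
      obtain ⟨t', A', hA', rfl⟩ := hmem X (hS hX)
      have htt : t ≠ t' := fun h => hXt A' hA' (by rw [h])
      have hD' := h _ hX₀ _ hX fun h => htt (transversalJoin_injective h).1
      obtain ⟨i, hi⟩ := Function.ne_iff.mp htt
      have hiD : ∀ y, Sum.inl (i, y) ∉ D := by
        intro y hy
        rw [← hD', Finset.mem_inter, inl_mem_transversalJoin, inl_mem_transversalJoin] at hy
        exact hi (hy.1.trans hy.2.symm)
      have hval : ∀ Y ∈ S, ∃ y, Sum.inl (i, y) ∈ Y := by
        intro Y hY
        obtain ⟨s, B, -, rfl⟩ := hmem Y (hS hY)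
        exact ⟨s i, inl_mem_transversalJoin.mpr rfl⟩
      have : Nonempty (Fin q) := ⟨⟨0, hq⟩⟩
      choose! y hy using hval
      have := Finset.card_le_card_of_injOn (s := S) (t := Finset.univ) y
        (fun _ _ => Finset.mem_coe.mpr (Finset.mem_univ _)) (by
          intro Y hY Z hZ hYZ
          by_contra hne
          apply hiD (y Y)
          rw [← h Y hY Z hZ hne]
          exact Finset.mem_inter.mpr ⟨hy Y hY, hYZ ▸ hy Z hZ⟩)
      simp at this
      omega
  · intro F' hF' h
    have hFcard : F.card = q ^ a * H.card := by
      rw [hF, Finset.card_image_of_injective, Finset.card_product]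
      · simp
      · rintro ⟨t, A⟩ ⟨t', A'⟩ h
        exact Prod.ext_iff.mpr (transversalJoin_injective h)
    rcases F'.eq_empty_or_nonempty with rfl | ⟨X₀, hX₀⟩
    · simp
    obtain ⟨t, A₀, hA₀, rfl⟩ := hmem X₀ (hF' hX₀)
    obtain ⟨T, hT, rfl, hTc⟩ := hfix F' hF' t (by
      intro X hX
      obtain ⟨t', A', hA', rfl⟩ := hmem X (hF' hX)
      by_cases htt : t = t'
      · exact ⟨A', hA', by rw [htt]⟩
      · exact absurd (ha _ (card_transversalJoin_inter_lt htt A₀ A'))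
          (h _ hX₀ _ hX fun h => htt (transversalJoin_injective h).1))
    have := hH.avoid T hT fun A hA B hB hAB hAL => by
      refine h _ (Finset.mem_image_of_mem _ hA) _ (Finset.mem_image_of_mem _ hB)
        ((hinj t).ne hAB) ?_
      rw [transversalJoin_inter, card_transversalJoin]
      exact (hL _).mpr hAL
    rw [← hTc, hFcard, pow_add]
    calc _ = q ^ a * (T.card * q ^ e) := by ring
      _ ≤ q ^ a * (2 * H.card) := by gcongr
      _ = _ := by ring

/-! ### Rooted families -/

/-- A `(k + 1)`-uniform family `F` each of whose members contains exactly one point of `U`, without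
sunflowers with `q + 1` petals whose kernel meets `U` or has size in `L`, such that in each
`L`-avoiding subfamily only a fraction `1 / K` of the points of `U` have degree above one. -/
structure IsRooted {α : Type*} [DecidableEq α] (k q K : ℕ) (L : Finset ℕ)
    (F : Finset (Finset α)) (U : Finset α) : Prop where
  nonempty : U.Nonempty
  uniform : IsUniform (k + 1) F
  root : ∀ A ∈ F, (A ∩ U).card = 1
  degree : ∀ u ∈ U, (F.filter fun A => u ∈ A).card = q ^ k
  no_sunflower : ∀ S ⊆ F, S.card = q + 1 → ∀ D : Finset α, D.card ∈ L → ¬ PairwiseInter D S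
  no_rooted_sunflower : ∀ S ⊆ F, S.card = q + 1 → ∀ D : Finset α, ∀ u ∈ U, u ∈ D →
    ¬ PairwiseInter D S
  avoid : ∀ F' ⊆ F, AvoidsIntersections L F' →
    K * (U.filter fun u => 2 ≤ (F'.filter fun A => u ∈ A).card).card ≤ U.card

lemma isRooted_single (q K : ℕ) (hq : 1 ≤ q) (L : Finset ℕ) :
    IsRooted 0 q K L {{()}} {()} := by
  have hcard : ∀ S : Finset (Finset Unit), S ⊆ {{()}} → S.card ≤ 1 := fun S hS => by
    simpa using Finset.card_le_card hS
  refine ⟨⟨(), by simp⟩, ?_, ?_, ?_, ?_, ?_, ?_⟩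
  · intro A hA
    rw [Finset.mem_singleton.mp hA]; simp
  · intro A hA
    rw [Finset.mem_singleton.mp hA]; simp
  · intro u _
    simp [Finset.filter_singleton]
  · intro S hS hSc
    have := hcard S hS
    omega
  · intro S hS hSc
    have := hcard S hS
    omega
  · intro F' hF' _
    rw [Finset.filter_false_of_mem]
    · simp
    · intro u _
      have := hcard _ ((Finset.filter_subset (fun A => u ∈ A) F').trans hF')
      omega

/-- Count members by their root. Roots of degree at most one contribute at most `U.card`. The others
have degree at most `q ^ k` but form at most a fraction `1 / q ^ k` of `U`, so they contribute at
most `U.card` again. -/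
lemma IsRooted.isTight {α : Type*} [DecidableEq α] {k q : ℕ} {L : Finset ℕ}
    {F : Finset (Finset α)} {U : Finset α} (h : IsRooted k q (q ^ k) L F U) (hq : 1 ≤ q) :
    IsTight (k + 1) q k L F := by
  have hcount : ∀ F' ⊆ F, F'.card = ∑ u ∈ U, (F'.filter fun A => u ∈ A).card := by
    intro F' hF'
    calc F'.card = ∑ A ∈ F', (A ∩ U).card := by
          rw [Finset.card_eq_sum_ones]
          exact Finset.sum_congr rfl fun A hA => (h.root A (hF' hA)).symm
      _ = ∑ A ∈ F', (U.filter fun u => u ∈ A).card := by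
          refine Finset.sum_congr rfl fun A _ => ?_
          rw [Finset.inter_comm, Finset.filter_mem_eq_inter]
      _ = _ := by
          simp only [Finset.card_filter]
          exact Finset.sum_comm
  have hF : F.card = U.card * q ^ k := by
    rw [hcount F le_rfl, Finset.sum_congr rfl h.degree, Finset.sum_const, smul_eq_mul]
  refine ⟨?_, h.uniform, h.no_sunflower, ?_⟩
  · rw [← Finset.card_pos, hF]
    have := h.nonempty.card_pos
    positivity
  · intro F' hF' hav
    have hle : F'.card ≤ 2 * U.card := by
      rw [hcount F' hF']
      calc _ ≤ ∑ u ∈ U, (1 + if 2 ≤ (F'.filter fun A => u ∈ A).card then q ^ k else 0) := by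
            refine Finset.sum_le_sum fun u hu => ?_
            split_ifs with h2
            · have := Finset.card_le_card (Finset.filter_subset_filter (fun A => u ∈ A) hF')
              rw [h.degree u hu] at this
              omega
            · omega
        _ = U.card +
              q ^ k * (U.filter fun u => 2 ≤ (F'.filter fun A => u ∈ A).card).card := by
            rw [Finset.sum_add_distrib, ← Finset.sum_filter, Finset.sum_const, Finset.sum_const]
            simp [mul_comm]
        _ ≤ 2 * U.card := by
            have := h.avoid F' hF' hav
            omega
    rw [hF, ← mul_assoc]
    gcongr

/-! ### Adding private leaves -/

section addLeaf

variable {α : Type*} {q : ℕ}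

/-- The set `A` with one of `q` new points that are private to `A`. -/
def addLeaf (A : Finset α) (y : Fin q) : Finset (α ⊕ (Finset α × Fin q)) :=
  A.disjSum {(A, y)}

lemma toLeft_addLeaf (A : Finset α) (y : Fin q) : (addLeaf A y).toLeft = A := by
  simp [addLeaf]

lemma inl_mem_addLeaf {A : Finset α} {y : Fin q} {x : α} :
    Sum.inl x ∈ addLeaf A y ↔ x ∈ A := by
  simp [addLeaf]

lemma addLeaf_injective {A A' : Finset α} {y y' : Fin q} (h : addLeaf A y = addLeaf A' y') :
    A = A' ∧ y = y' := by
  have := congrArg Finset.toRight h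
  simpa [addLeaf] using this

variable [DecidableEq α]

lemma addLeaf_inter_of_ne {A A' : Finset α} (h : A ≠ A') (y y' : Fin q) :
    addLeaf A y ∩ addLeaf A' y' = (A ∩ A').disjSum ∅ := by
  rw [addLeaf, addLeaf, disjSum_inter_disjSum, Finset.inter_singleton_of_notMem]
  simp [h.symm]

lemma addLeaf_inter_self (A : Finset α) {y y' : Fin q} (h : y ≠ y') :
    addLeaf A y ∩ addLeaf A y' = A.disjSum ∅ := by
  rw [addLeaf, addLeaf, disjSum_inter_disjSum, Finset.inter_singleton_of_notMem,
    Finset.inter_self]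
  simp [h.symm]

/-- The family obtained by adding a leaf to each member of `G` in all `q` ways. -/
def leafFamily (q : ℕ) (G : Finset (Finset α)) : Finset (Finset (α ⊕ (Finset α × Fin q))) :=
  (G ×ˢ Finset.univ).image fun p => addLeaf p.1 p.2

lemma mem_leafFamily {G : Finset (Finset α)} {X : Finset (α ⊕ (Finset α × Fin q))} :
    X ∈ leafFamily q G ↔ ∃ A ∈ G, ∃ y, X = addLeaf A y := by
  simp only [leafFamily, Finset.mem_image, Finset.mem_product, Finset.mem_univ, and_true,
    Prod.exists]
  constructor
  · rintro ⟨A, y, hA, rfl⟩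
    exact ⟨A, hA, y, rfl⟩
  · rintro ⟨A, hA, y, rfl⟩
    exact ⟨A, y, hA, rfl⟩

/-- If two petals extend the same `A`, the kernel is `A`, so by uniformity every petal extends `A`,
and only `q` sets do. Hence deleting leaves is injective on the petals and leaves a sunflower with
the same kernel. -/
lemma exists_pairwiseInter_of_leafFamily {k : ℕ} {G : Finset (Finset α)} (hG : IsUniform k G)
    (hq : 1 ≤ q) {S : Finset (Finset (α ⊕ (Finset α × Fin q)))} (hS : S ⊆ leafFamily q G)
    (hSc : S.card = q + 1) {D : Finset (α ⊕ (Finset α × Fin q))} (h : PairwiseInter D S) :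
    ∃ T ⊆ G, T.card = q + 1 ∧ ∃ D', D = D'.disjSum ∅ ∧ PairwiseInter D' T := by
  have hS' := fun X (hX : X ∈ S) => mem_leafFamily.mp (hS hX)
  by_cases hinj : Set.InjOn Finset.toLeft (S : Set (Finset (α ⊕ (Finset α × Fin q))))
  · refine ⟨S.image Finset.toLeft, ?_, by rw [Finset.card_image_of_injOn hinj, hSc],
      D.toLeft, ?_, ?_⟩
    · intro A hA
      obtain ⟨X, hX, rfl⟩ := Finset.mem_image.mp hA
      obtain ⟨A, hA, y, rfl⟩ := hS' X hX
      rwa [toLeft_addLeaf]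
    · obtain ⟨X, hX, Y, hY, hXY⟩ := Finset.one_lt_card.mp (by omega : 1 < S.card)
      have hne : X.toLeft ≠ Y.toLeft := fun h => hXY (hinj hX hY h)
      have hD := h X hX Y hY hXY
      obtain ⟨A, hA, y, rfl⟩ := hS' X hX
      obtain ⟨B, hB, z, rfl⟩ := hS' Y hY
      rw [toLeft_addLeaf, toLeft_addLeaf] at hne
      rw [← hD, addLeaf_inter_of_ne hne, Finset.toLeft_disjSum]
    · intro A hA B hB hAB
      obtain ⟨X, hX, rfl⟩ := Finset.mem_image.mp hA
      obtain ⟨Y, hY, rfl⟩ := Finset.mem_image.mp hB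
      rw [← h X hX Y hY (fun h => hAB (by rw [h])), Finset.toLeft_inter]
  · exfalso
    rw [Set.InjOn] at hinj
    push Not at hinj
    obtain ⟨X, hX, Y, hY, hXY, hne⟩ := hinj
    have hD := h X hX Y hY hne
    obtain ⟨A, hA, y, rfl⟩ := hS' X hX
    obtain ⟨B, hB, z, rfl⟩ := hS' Y hY
    rw [toLeft_addLeaf, toLeft_addLeaf] at hXY
    subst hXY
    rw [addLeaf_inter_self A (fun h => hne (by rw [h]))] at hD
    have hsub : S ⊆ Finset.univ.image (addLeaf A) := by
      intro Z hZ
      have hDZ := h.subset (by omega) hZ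
      obtain ⟨C, hC, w, rfl⟩ := hS' Z hZ
      have hAC : A ⊆ C := fun x hx => inl_mem_addLeaf.mp (hDZ (by rw [← hD]; simpa using hx))
      rw [Finset.eq_of_subset_of_card_le hAC (by rw [hG A hA, hG C hC])]
      exact Finset.mem_image_of_mem _ (Finset.mem_univ _)
    have := (Finset.card_le_card hsub).trans Finset.card_image_le
    simp at this
    omega

end addLeaf

/-- Two extensions of one `A` meet in `k + 1 ∈ L` points, so an avoiding subfamily keeps at most one
of them. Degrees in the whole family grow by `q`, while avoiding subfamilies project injectively to
avoiding subfamilies of `G`. -/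
lemma IsRooted.leafFamily {α : Type*} [DecidableEq α] {k q K : ℕ} {L : Finset ℕ}
    {G : Finset (Finset α)} {U : Finset α} (h : IsRooted k q K L G U) (hq : 1 ≤ q)
    (hkL : k + 1 ∈ L) : IsRooted (k + 1) q K L (leafFamily q G) (U.disjSum ∅) := by
  have hmemU : ∀ v, v ∈ U.disjSum (∅ : Finset (Finset α × Fin q)) ↔
      ∃ u ∈ U, v = Sum.inl u := by
    rintro (v | v) <;> simp
  refine ⟨?_, ?_, ?_, ?_, ?_, ?_, ?_⟩
  · obtain ⟨u, hu⟩ := h.nonempty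
    exact ⟨Sum.inl u, by simpa using hu⟩
  · intro X hX
    obtain ⟨A, hA, y, rfl⟩ := mem_leafFamily.mp hX
    simp [addLeaf, h.uniform A hA]
  · intro X hX
    obtain ⟨A, hA, y, rfl⟩ := mem_leafFamily.mp hX
    rw [addLeaf, disjSum_inter_disjSum]
    simp [h.root A hA]
  · intro v hv
    obtain ⟨u, hu, rfl⟩ := (hmemU v).mp hv
    have : ((_root_.leafFamily q G).filter fun X => Sum.inl u ∈ X) =
        ((G.filter fun A => u ∈ A) ×ˢ (Finset.univ : Finset (Fin q))).image
          fun p => addLeaf p.1 p.2 := by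
      ext X
      simp only [Finset.mem_filter, mem_leafFamily, Finset.mem_image, Finset.mem_product,
        Finset.mem_univ, and_true, Prod.exists]
      constructor
      · rintro ⟨⟨A, hA, y, rfl⟩, hu⟩
        exact ⟨A, y, ⟨hA, inl_mem_addLeaf.mp hu⟩, rfl⟩
      · rintro ⟨A, y, ⟨hA, hu⟩, rfl⟩
        exact ⟨⟨A, hA, y, rfl⟩, inl_mem_addLeaf.mpr hu⟩
    rw [this, Finset.card_image_of_injective _ fun p p' h =>
      Prod.ext_iff.mpr (addLeaf_injective h), Finset.card_product, h.degree u hu, pow_succ]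
    simp
  · intro S hS hSc D hD hp
    obtain ⟨T, hT, hTc, D', rfl, hp'⟩ :=
      exists_pairwiseInter_of_leafFamily h.uniform hq hS hSc hp
    exact h.no_sunflower T hT hTc D' (by simpa using hD) hp'
  · intro S hS hSc D v hv hvD hp
    obtain ⟨u, hu, rfl⟩ := (hmemU v).mp hv
    obtain ⟨T, hT, hTc, D', rfl, hp'⟩ :=
      exists_pairwiseInter_of_leafFamily h.uniform hq hS hSc hp
    exact h.no_rooted_sunflower T hT hTc D' u hu (by simpa using hvD) hp'
  · intro F' hF' hav
    have hF := fun X (hX : X ∈ F') => mem_leafFamily.mp (hF' hX)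
    have hne : ∀ X ∈ F', ∀ Y ∈ F', X ≠ Y → X.toLeft ≠ Y.toLeft ∧
        (X ∩ Y).card = (X.toLeft ∩ Y.toLeft).card := by
      intro X hX Y hY hXY
      have hav' := hav X hX Y hY hXY
      obtain ⟨A, hA, y, rfl⟩ := hF X hX
      obtain ⟨B, hB, z, rfl⟩ := hF Y hY
      rw [toLeft_addLeaf, toLeft_addLeaf]
      by_cases hAB : A = B
      · subst hAB
        rw [addLeaf_inter_self A (fun h => hXY (by rw [h]))] at hav'
        simp [h.uniform A hA, hkL] at hav'
      · refine ⟨hAB, ?_⟩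
        rw [addLeaf_inter_of_ne hAB]
        simp
    have hinj : Set.InjOn Finset.toLeft (F' : Set (Finset (α ⊕ (Finset α × Fin q)))) := by
      intro X hX Y hY hXY
      by_contra hc
      exact (hne X hX Y hY hc).1 hXY
    have key := h.avoid (F'.image Finset.toLeft) (by
      intro A hA
      obtain ⟨X, hX, rfl⟩ := Finset.mem_image.mp hA
      obtain ⟨A, hA, y, rfl⟩ := hF X hX
      rwa [toLeft_addLeaf]) (by
      intro A hA B hB hAB
      obtain ⟨X, hX, rfl⟩ := Finset.mem_image.mp hA
      obtain ⟨Y, hY, rfl⟩ := Finset.mem_image.mp hB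
      have hXY : X ≠ Y := fun h => hAB (by rw [h])
      rw [← (hne X hX Y hY hXY).2]
      exact hav X hX Y hY hXY)
    have hdeg : ∀ u, ((F'.image Finset.toLeft).filter fun A => u ∈ A).card =
        (F'.filter fun X => Sum.inl u ∈ X).card := by
      intro u
      rw [Finset.filter_image, Finset.card_image_of_injOn (hinj.mono
        (Finset.coe_subset.mpr (Finset.filter_subset _ _)))]
      simp only [Finset.mem_toLeft]
    simp only [hdeg] at key
    rw [Finset.card_disjSum, Finset.card_empty, add_zero]
    refine le_trans ?_ key
    gcongr
    refine (Finset.card_le_card (t := (U.filter fun u =>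
      2 ≤ (F'.filter fun X => Sum.inl u ∈ X).card).image Sum.inl) ?_).trans Finset.card_image_le
    intro v hv
    rw [Finset.mem_filter] at hv
    obtain ⟨u, hu, rfl⟩ := (hmemU v).mp hv.1
    exact Finset.mem_image_of_mem _ (Finset.mem_filter.mpr ⟨hu, hv.2⟩)

/-! ### Adding new roots -/

section addRoot

variable {α : Type*} {q N : ℕ}

/-- The root `w` together with the `j`-th copy of `A`. -/
def addRoot (w : (Fin q → α) × Fin N) (j : Fin q) (A : Finset α) :
    Finset (((Fin q → α) × Fin N) ⊕ (Fin q × α)) :=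
  ({w} : Finset _).disjSum (({j} : Finset (Fin q)) ×ˢ A)

lemma inl_mem_addRoot {w v : (Fin q → α) × Fin N} {j : Fin q} {A : Finset α} :
    Sum.inl v ∈ addRoot w j A ↔ v = w := by
  simp [addRoot]

lemma inr_mem_addRoot {w : (Fin q → α) × Fin N} {i j : Fin q} {A : Finset α} {x : α} :
    Sum.inr (i, x) ∈ addRoot w j A ↔ i = j ∧ x ∈ A := by
  simp [addRoot, and_comm, eq_comm]

lemma addRoot_eq_iff {w w' : (Fin q → α) × Fin N} {j j' : Fin q} {A A' : Finset α}
    (hA : A.Nonempty) : addRoot w j A = addRoot w' j' A' ↔ w = w' ∧ j = j' ∧ A = A' := by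
  refine ⟨fun h => ?_, by rintro ⟨rfl, rfl, rfl⟩; rfl⟩
  have hw : w = w' := inl_mem_addRoot.mp (h ▸ inl_mem_addRoot.mpr rfl)
  obtain ⟨x, hx⟩ := hA
  have hj : j = j' := (inr_mem_addRoot.mp (h ▸ inr_mem_addRoot.mpr ⟨rfl, hx⟩)).1
  subst hj
  exact ⟨hw, rfl, singleton_product_injective j (by simpa [addRoot] using congrArg Finset.toRight h)⟩

lemma card_addRoot (w : (Fin q → α) × Fin N) (j : Fin q) (A : Finset α) :
    (addRoot w j A).card = A.card + 1 := by
  simp [addRoot, add_comm]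

/-- The admissible roots: a choice of a point of `U` in each of `q` copies, with `N` repetitions. -/
def rootSet (q N : ℕ) (U : Finset α) : Finset ((Fin q → α) × Fin N) :=
  (Fintype.piFinset fun _ => U) ×ˢ Finset.univ

lemma mem_rootSet {U : Finset α} {w : (Fin q → α) × Fin N} :
    w ∈ rootSet q N U ↔ ∀ j, w.1 j ∈ U := by
  simp [rootSet]

/-- The members of `G` whose `j`-th copy is joined to two different roots within `F'`. -/
noncomputable def repeated (G : Finset (Finset α))
    (F' : Finset (Finset (((Fin q → α) × Fin N) ⊕ (Fin q × α)))) (j : Fin q) :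
    Finset (Finset α) :=
  open Classical in
  G.filter fun A => ∃ w w', w ≠ w' ∧ addRoot w j A ∈ F' ∧ addRoot w' j A ∈ F'

lemma mem_repeated {G : Finset (Finset α)}
    {F' : Finset (Finset (((Fin q → α) × Fin N) ⊕ (Fin q × α)))} {j : Fin q} {A : Finset α} :
    A ∈ repeated G F' j ↔
      A ∈ G ∧ ∃ w w', w ≠ w' ∧ addRoot w j A ∈ F' ∧ addRoot w' j A ∈ F' := by
  simp only [repeated, Finset.mem_filter]

variable [DecidableEq α]

lemma addRoot_inter_of_ne_index {w : (Fin q → α) × Fin N} {j j' : Fin q} (h : j ≠ j')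
    (A A' : Finset α) : (addRoot w j A ∩ addRoot w j' A').card = 1 := by
  rw [addRoot, addRoot, disjSum_inter_disjSum, Finset.product_inter_product,
    Finset.inter_self,
    Finset.inter_singleton_of_notMem (fun hj => h (Finset.mem_singleton.mp hj).symm)]
  simp

lemma addRoot_inter_of_ne {w w' : (Fin q → α) × Fin N} (h : w ≠ w') (j : Fin q)
    (A A' : Finset α) :
    addRoot w j A ∩ addRoot w' j A' = (∅ : Finset _).disjSum ({j} ×ˢ (A ∩ A')) := by
  rw [addRoot, addRoot, disjSum_inter_disjSum, Finset.product_inter_product,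
    Finset.inter_singleton_of_notMem (by simpa using h.symm), Finset.inter_self]

lemma addRoot_inter_self (w : (Fin q → α) × Fin N) (j : Fin q) (A A' : Finset α) :
    addRoot w j A ∩ addRoot w j A' = addRoot w j (A ∩ A') := by
  rw [addRoot, addRoot, disjSum_inter_disjSum, Finset.product_inter_product,
    Finset.inter_self, Finset.inter_self, addRoot]

/-- Each root is joined to the members of `G` that contain the chosen point in their copy. -/
def rootFamily (q N : ℕ) (G : Finset (Finset α)) (U : Finset α) :
    Finset (Finset (((Fin q → α) × Fin N) ⊕ (Fin q × α))) :=
  ((rootSet q N U ×ˢ (Finset.univ ×ˢ G)).filter fun p => p.1.1 p.2.1 ∈ p.2.2).image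
    fun p => addRoot p.1 p.2.1 p.2.2

lemma mem_rootFamily {G : Finset (Finset α)} {U : Finset α}
    {X : Finset (((Fin q → α) × Fin N) ⊕ (Fin q × α))} :
    X ∈ rootFamily q N G U ↔
      ∃ w ∈ rootSet q N U, ∃ j, ∃ A ∈ G, w.1 j ∈ A ∧ X = addRoot w j A := by
  simp only [rootFamily, Finset.mem_image, Finset.mem_filter, Finset.mem_product, Finset.mem_univ,
    true_and, Prod.exists]
  constructor
  · rintro ⟨f, n, j, A, ⟨⟨hw, hA⟩, hj⟩, rfl⟩
    exact ⟨f, n, hw, j, A, hA, hj, rfl⟩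
  · rintro ⟨f, n, hw, j, A, hA, hj, rfl⟩
    exact ⟨f, n, j, A, ⟨⟨hw, hA⟩, hj⟩, rfl⟩

/-- Undo the tagging of the second summand. -/
def untag (X : Finset (((Fin q → α) × Fin N) ⊕ (Fin q × α))) : Finset α :=
  X.toRight.image Prod.snd

lemma mem_untag {X : Finset (((Fin q → α) × Fin N) ⊕ (Fin q × α))} {x : α} :
    x ∈ untag X ↔ ∃ j, Sum.inr (j, x) ∈ X := by
  simp [untag]

lemma untag_addRoot (w : (Fin q → α) × Fin N) (j : Fin q) (A : Finset α) :
    untag (addRoot w j A) = A := by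
  ext x
  simp [mem_untag, inr_mem_addRoot]

/-- Petals through `w` in pairwise different copies number at most `q`. Two petals in the same copy
`j` share the chosen point `w.1 j`, which then lies in the kernel and forces all petals into copy
`j`. This gives a sunflower in `G` whose kernel meets `U`, of arbitrary size; hence the condition
`no_rooted_sunflower` in the induction. -/
lemma not_pairwiseInter_of_inl_mem {k K : ℕ} {L : Finset ℕ} {G : Finset (Finset α)}
    {U : Finset α} (h : IsRooted k q K L G U) (hq : 1 ≤ q)
    {S : Finset (Finset (((Fin q → α) × Fin N) ⊕ (Fin q × α)))} (hS : S ⊆ rootFamily q N G U)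
    (hSc : S.card = q + 1) {D : Finset (((Fin q → α) × Fin N) ⊕ (Fin q × α))}
    {w : (Fin q → α) × Fin N} (hw : Sum.inl w ∈ D) : ¬ PairwiseInter D S := by
  intro hp
  have hS' : ∀ X ∈ S, ∃ j, w.1 j ∈ U ∧ untag X ∈ G ∧ w.1 j ∈ untag X ∧
      X = addRoot w j (untag X) := by
    intro X hX
    have hwX := hp.subset (by omega) hX hw
    obtain ⟨w', hw', j, A, hA, hj, rfl⟩ := mem_rootFamily.mp (hS hX)
    obtain rfl := inl_mem_addRoot.mp hwX
    rw [untag_addRoot]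
    exact ⟨j, mem_rootSet.mp hw' j, hA, hj, rfl⟩
  have : Nonempty (Fin q) := ⟨⟨0, hq⟩⟩
  choose! j hjU hG hjX hX using hS'
  have hmemX : ∀ X ∈ S, ∀ v, v ∈ X ↔ v ∈ addRoot w (j X) (untag X) := fun X hXS v => by
    conv_lhs => rw [hX X hXS]
  by_cases hinj : Set.InjOn j S
  · have := Finset.card_le_card_of_injOn (t := Finset.univ) j
      (fun _ _ => Finset.mem_coe.mpr (Finset.mem_univ _)) hinj
    simp at this
    omega
  · rw [Set.InjOn] at hinj
    push Not at hinj
    obtain ⟨X, hXS, Y, hYS, hXY, hne⟩ := hinj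
    have huD : Sum.inr (j X, w.1 (j X)) ∈ D := by
      rw [← hp X hXS Y hYS hne, Finset.mem_inter]
      constructor
      · rw [hmemX X hXS]
        exact inr_mem_addRoot.mpr ⟨rfl, hjX X hXS⟩
      · rw [hmemX Y hYS]
        exact inr_mem_addRoot.mpr ⟨hXY, hXY ▸ hjX Y hYS⟩
    have hj : ∀ Z ∈ S, j Z = j X := by
      intro Z hZ
      have := hp.subset (by omega) hZ huD
      rw [hX Z hZ] at this
      exact (inr_mem_addRoot.mp this).1.symm
    have hinj' : Set.InjOn untag (S : Set (Finset (((Fin q → α) × Fin N) ⊕ (Fin q × α)))) := by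
      intro Y hY Z hZ hYZ
      rw [hX Y hY, hX Z hZ, hj Y hY, hj Z hZ, hYZ]
    refine h.no_rooted_sunflower (S.image untag) ?_ ?_ (untag D) _ (hjU X hXS)
      (mem_untag.mpr ⟨_, huD⟩) ?_
    · intro A hA
      obtain ⟨Y, hY, rfl⟩ := Finset.mem_image.mp hA
      exact hG Y hY
    · rw [Finset.card_image_of_injOn hinj', hSc]
    · intro A hA B hB hAB
      obtain ⟨Y, hY, rfl⟩ := Finset.mem_image.mp hA
      obtain ⟨Z, hZ, rfl⟩ := Finset.mem_image.mp hB
      have hYZ := hp Y hY Z hZ (fun h => hAB (by rw [h]))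
      rw [← hYZ]
      conv_rhs => rw [hX Y hY, hX Z hZ, hj Y hY, hj Z hZ, addRoot_inter_self, untag_addRoot]

/-- As `0 ∉ L`, the kernel has a point, which fixes the copy; the petals have different roots. Two
petals over the same member of `G` would give a kernel of size `k + 1 ∉ L`, so the petals project to
a sunflower in `G` with kernel of the same size. -/
lemma not_pairwiseInter_of_inl_notMem {k K : ℕ} {L : Finset ℕ} {G : Finset (Finset α)}
    {U : Finset α} (h : IsRooted k q K L G U) (hq : 1 ≤ q) (hL0 : 0 ∉ L) (hkL : k + 1 ∉ L)
    {S : Finset (Finset (((Fin q → α) × Fin N) ⊕ (Fin q × α)))} (hS : S ⊆ rootFamily q N G U)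
    (hSc : S.card = q + 1) {D : Finset (((Fin q → α) × Fin N) ⊕ (Fin q × α))}
    (hD : D.card ∈ L) (hw : ∀ w, Sum.inl w ∉ D) : ¬ PairwiseInter D S := by
  intro hp
  obtain ⟨v, hv⟩ : D.Nonempty := by
    rw [Finset.nonempty_iff_ne_empty]
    rintro rfl
    exact hL0 hD
  rcases v with w | ⟨j, x⟩
  · exact hw w hv
  have hS' : ∀ X ∈ S, ∃ w, untag X ∈ G ∧ X = addRoot w j (untag X) := by
    intro X hX
    have hjX := hp.subset (by omega) hX hv
    obtain ⟨w, hw', i, A, hA, hi, rfl⟩ := mem_rootFamily.mp (hS hX)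
    obtain ⟨rfl, -⟩ := inr_mem_addRoot.mp hjX
    rw [untag_addRoot]
    exact ⟨w, hA, rfl⟩
  have hinter : ∀ X ∈ S, ∀ Y ∈ S, X ≠ Y →
      D = (∅ : Finset _).disjSum (({j} : Finset (Fin q)) ×ˢ (untag X ∩ untag Y)) := by
    intro X hX Y hY hXY
    have hD' := hp X hX Y hY hXY
    obtain ⟨w, -, h1⟩ := hS' X hX
    obtain ⟨w', -, h2⟩ := hS' Y hY
    have hww : w ≠ w' := by
      rintro rfl
      refine hw w ?_
      rw [← hD', h1, h2, addRoot_inter_self]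
      exact inl_mem_addRoot.mpr rfl
    rw [← addRoot_inter_of_ne hww, ← h1, ← h2, hD']
  have hcard : ∀ X ∈ S, ∀ Y ∈ S, X ≠ Y → D.card = (untag X ∩ untag Y).card := by
    intro X hX Y hY hXY
    rw [hinter X hX Y hY hXY]
    simp
  have hinj : Set.InjOn untag (S : Set (Finset (((Fin q → α) × Fin N) ⊕ (Fin q × α)))) := by
    intro X hX Y hY hXY
    by_contra hne
    have := hcard X hX Y hY hne
    obtain ⟨-, hG, -⟩ := hS' Y hY
    rw [hXY, Finset.inter_self, h.uniform _ hG] at this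
    exact hkL (this ▸ hD)
  have hinter' : ∀ X ∈ S, ∀ Y ∈ S, X ≠ Y → untag X ∩ untag Y = untag D := by
    intro X hX Y hY hXY
    ext y
    rw [mem_untag, hinter X hX Y hY hXY]
    simp
  obtain ⟨X, hX, Y, hY, hXY⟩ := Finset.one_lt_card.mp (by omega : 1 < S.card)
  refine h.no_sunflower (S.image untag) ?_ ?_ (untag D) ?_ ?_
  · intro A hA
    obtain ⟨Y, hY, rfl⟩ := Finset.mem_image.mp hA
    obtain ⟨-, hG, -⟩ := hS' Y hY
    exact hG
  · rw [Finset.card_image_of_injOn hinj, hSc]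
  · rw [← hinter' X hX Y hY hXY, ← hcard X hX Y hY hXY]
    exact hD
  · intro A hA B hB hAB
    obtain ⟨Y, hY, rfl⟩ := Finset.mem_image.mp hA
    obtain ⟨Z, hZ, rfl⟩ := Finset.mem_image.mp hB
    exact hinter' Y hY Z hZ (fun h => hAB (by rw [h]))

/-- For a uniformly random root `w`, the point `w.1 j` is uniform in `U`. -/
lemma card_rootSet_filter_mul_le (U B : Finset α) (j : Fin q) {M : ℕ}
    (h : M * B.card ≤ U.card) :
    M * ((rootSet q N U).filter fun w => w.1 j ∈ B).card ≤ (rootSet q N U).card := by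
  have hle : ((rootSet q N U).filter fun w => w.1 j ∈ B) ⊆
      (Fintype.piFinset (Function.update (fun _ => U) j B)) ×ˢ Finset.univ := by
    intro w hw
    rw [Finset.mem_filter, mem_rootSet] at hw
    rw [Finset.mem_product, Fintype.mem_piFinset]
    refine ⟨fun i => ?_, Finset.mem_univ _⟩
    by_cases hi : i = j
    · subst hi
      simpa using hw.2
    · simpa [Function.update_of_ne hi] using hw.1 i
  have hprod : ∀ V : Finset α,
      (Fintype.piFinset (Function.update (fun _ : Fin q => U) j V)).card =
        V.card * ∏ i ∈ Finset.univ.erase j, U.card := by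
    intro V
    rw [Fintype.card_piFinset, ← Finset.mul_prod_erase _ _ (Finset.mem_univ j),
      Function.update_self]
    congr 1
    exact Finset.prod_congr rfl fun i hi => by
      rw [Function.update_of_ne (Finset.ne_of_mem_erase hi)]
  have hU := hprod U
  rw [Function.update_eq_self] at hU
  calc _ ≤ M * (B.card * (∏ i ∈ Finset.univ.erase j, U.card) * N) := by
        gcongr
        refine (Finset.card_le_card hle).trans ?_
        rw [Finset.card_product, hprod, Finset.card_univ, Fintype.card_fin]
    _ = (M * B.card) * (∏ i ∈ Finset.univ.erase j, U.card) * N := by ring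
    _ ≤ U.card * (∏ i ∈ Finset.univ.erase j, U.card) * N := by gcongr
    _ = _ := by
        rw [rootSet, Finset.card_product, hU, Finset.card_univ, Fintype.card_fin]

lemma card_rootFamily_degree {k K : ℕ} {L : Finset ℕ} {G : Finset (Finset α)}
    {U : Finset α} (h : IsRooted k q K L G U) {w : (Fin q → α) × Fin N}
    (hw : w ∈ rootSet q N U) :
    ((rootFamily q N G U).filter fun X => Sum.inl w ∈ X).card = q ^ (k + 1) := by
  have heq : ((rootFamily q N G U).filter fun X => Sum.inl w ∈ X) =
      ((Finset.univ : Finset (Fin q)).sigma fun j => G.filter fun A => w.1 j ∈ A).image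
        fun p => addRoot w p.1 p.2 := by
    ext X
    simp only [Finset.mem_filter, mem_rootFamily, Finset.mem_image, Finset.mem_sigma,
      Finset.mem_univ, true_and, Sigma.exists]
    constructor
    · rintro ⟨⟨w', hw', j, A, hA, hj, rfl⟩, hX⟩
      obtain rfl := inl_mem_addRoot.mp hX
      exact ⟨j, A, ⟨hA, hj⟩, rfl⟩
    · rintro ⟨j, A, ⟨hA, hj⟩, rfl⟩
      exact ⟨⟨w, hw, j, A, hA, hj, rfl⟩, inl_mem_addRoot.mpr rfl⟩
  rw [heq, Finset.card_image_of_injOn, Finset.card_sigma,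
    Finset.sum_congr rfl fun j _ => h.degree _ (mem_rootSet.mp hw j)]
  · simp [pow_succ, mul_comm]
  · rintro ⟨j, A⟩ hA ⟨j', A'⟩ hA' heq
    simp only [Finset.coe_sigma, Set.mem_sigma_iff, Finset.mem_coe, Finset.mem_filter] at hA
    obtain ⟨-, rfl, rfl⟩ := (addRoot_eq_iff ⟨_, hA.2.2⟩).mp heq
    rfl

/-- Having two roots to choose from, `B` can be paired with a root different from that of `A`; the
two sets in `F'` then meet in a copy of `A ∩ B` alone. -/
lemma repeated_avoids {L : Finset ℕ} {G : Finset (Finset α)}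
    {F' : Finset (Finset (((Fin q → α) × Fin N) ⊕ (Fin q × α)))}
    (hav : AvoidsIntersections L F') (j : Fin q) :
    AvoidsIntersections L (repeated G F' j) := by
  intro A hA B hB hAB
  obtain ⟨-, w, -, -, hw, -⟩ := mem_repeated.mp hA
  obtain ⟨-, v, v', hvv, hv, hv'⟩ := mem_repeated.mp hB
  have key : ∀ u, w ≠ u → addRoot u j B ∈ F' → (A ∩ B).card ∉ L := by
    intro u hwu hu
    have := hav _ hw _ hu fun h => hwu (inl_mem_addRoot.mp (h ▸ inl_mem_addRoot.mpr rfl))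
    rw [addRoot_inter_of_ne hwu] at this
    simpa using this
  by_cases hwv : w = v
  · exact key v' (hwv ▸ hvv) hv'
  · exact key v hwv hv

/-- Two kept members at a root `w` come from one copy `j`, since members from different copies meet
only in `w` and `1 ∈ L`. If both are repeated, `w.1 j` has degree at least two in the avoiding
family `repeated G F' j`; over the `q` copies this happens for a fraction at most `1 / (2 * K)` of
the roots. A non-repeated member accounts for one root only, so the remaining bad roots number at
most `q * G.card`, again a fraction at most `1 / (2 * K)` by the size of `N`. -/
lemma mul_card_bad_roots_le {k K : ℕ} {L : Finset ℕ} {G : Finset (Finset α)}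
    {U : Finset α} (h : IsRooted k q (2 * K * q) L G U) (hL1 : 1 ∈ L) (hq : 1 ≤ q)
    (hN : 2 * K * (q * G.card) ≤ N)
    {F' : Finset (Finset (((Fin q → α) × Fin N) ⊕ (Fin q × α)))}
    (hF' : F' ⊆ rootFamily q N G U) (hav : AvoidsIntersections L F') :
    K * ((rootSet q N U).filter fun w => 2 ≤ (F'.filter fun X => Sum.inl w ∈ X).card).card ≤
      (rootSet q N U).card := by
  classical
  let B : Fin q → Finset α := fun j =>
    U.filter fun u => 2 ≤ ((repeated G F' j).filter fun A => u ∈ A).card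
  have hB : ∀ j, 2 * K * q * (B j).card ≤ U.card := fun j =>
    h.avoid _ (fun A hA => (mem_repeated.mp hA).1) (repeated_avoids hav j)
  let R : Fin q × Finset α → Finset ((Fin q → α) × Fin N) := fun p =>
    (rootSet q N U).filter fun w => p.2 ∉ repeated G F' p.1 ∧ addRoot w p.1 p.2 ∈ F'
  have hR : ∀ p ∈ (Finset.univ : Finset (Fin q)) ×ˢ G, (R p).card ≤ 1 := by
    rintro ⟨j, A⟩ hp
    rw [Finset.card_le_one]
    intro w hw w' hw'
    by_contra hne
    simp only [R, Finset.mem_filter] at hw hw'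
    exact hw.2.1 (mem_repeated.mpr
      ⟨(Finset.mem_product.mp hp).2, w, w', hne, hw.2.2, hw'.2.2⟩)
  have hsub : ((rootSet q N U).filter fun w =>
      2 ≤ (F'.filter fun X => Sum.inl w ∈ X).card) ⊆
      (Finset.univ.biUnion fun j => (rootSet q N U).filter fun w => w.1 j ∈ B j) ∪
        ((Finset.univ : Finset (Fin q)) ×ˢ G).biUnion R := by
    intro w hw
    rw [Finset.mem_filter] at hw
    obtain ⟨X, hX, Y, hY, hXY⟩ := Finset.one_lt_card.mp hw.2
    rw [Finset.mem_filter] at hX hY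
    have hav' := hav X hX.1 Y hY.1 hXY
    obtain ⟨w₁, -, j, A, hA, hj, rfl⟩ := mem_rootFamily.mp (hF' hX.1)
    obtain ⟨w₂, -, i, C, hC, hi, rfl⟩ := mem_rootFamily.mp (hF' hY.1)
    obtain rfl := inl_mem_addRoot.mp hX.2
    obtain rfl := inl_mem_addRoot.mp hY.2
    have hij : j = i := by
      by_contra hij
      rw [addRoot_inter_of_ne_index hij] at hav'
      exact hav' hL1
    subst hij
    have hAC : A ≠ C := fun h => hXY (by rw [h])
    rw [Finset.mem_union, Finset.mem_biUnion, Finset.mem_biUnion]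
    by_cases hAr : A ∈ repeated G F' j
    · by_cases hCr : C ∈ repeated G F' j
      · refine Or.inl ⟨j, Finset.mem_univ _, Finset.mem_filter.mpr ⟨hw.1, Finset.mem_filter.mpr
          ⟨mem_rootSet.mp hw.1 j, Finset.one_lt_card.mpr ⟨A, ?_, C, ?_, hAC⟩⟩⟩⟩
        · exact Finset.mem_filter.mpr ⟨hAr, hj⟩
        · exact Finset.mem_filter.mpr ⟨hCr, hi⟩
      · exact Or.inr ⟨(j, C), Finset.mem_product.mpr ⟨Finset.mem_univ _, hC⟩,
          Finset.mem_filter.mpr ⟨hw.1, hCr, hY.1⟩⟩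
    · exact Or.inr ⟨(j, A), Finset.mem_product.mpr ⟨Finset.mem_univ _, hA⟩,
        Finset.mem_filter.mpr ⟨hw.1, hAr, hX.1⟩⟩
  have hNle : N ≤ (rootSet q N U).card := by
    rw [rootSet, Finset.card_product, Finset.card_univ, Fintype.card_fin]
    have := (Fintype.piFinset_nonempty.mpr fun _ : Fin q => h.nonempty).card_pos
    exact Nat.le_mul_of_pos_left _ this
  have h1 : 2 * K * q * (Finset.univ.biUnion fun j =>
      (rootSet q N U).filter fun w => w.1 j ∈ B j).card ≤ q * (rootSet q N U).card := by
    calc _ ≤ 2 * K * q * ∑ j, ((rootSet q N U).filter fun w => w.1 j ∈ B j).card := by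
          gcongr
          exact Finset.card_biUnion_le
      _ = ∑ j, 2 * K * q * ((rootSet q N U).filter fun w => w.1 j ∈ B j).card :=
          Finset.mul_sum _ _ _
      _ ≤ ∑ _j : Fin q, (rootSet q N U).card := Finset.sum_le_sum fun j _ =>
          card_rootSet_filter_mul_le U (B j) j (hB j)
      _ = _ := by simp
  have h2 : (((Finset.univ : Finset (Fin q)) ×ˢ G).biUnion R).card ≤ q * G.card := by
    have := Finset.card_biUnion_le_card_mul _ R 1 hR
    simpa using this
  have h1' : 2 * K * (Finset.univ.biUnion fun j =>
      (rootSet q N U).filter fun w => w.1 j ∈ B j).card ≤ (rootSet q N U).card := by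
    refine Nat.le_of_mul_le_mul_left ?_ hq
    calc _ = _ := by ring
      _ ≤ _ := h1
  have h3 := (Finset.card_le_card hsub).trans (Finset.card_union_le _ _)
  have h4 : 2 * K * (((Finset.univ : Finset (Fin q)) ×ˢ G).biUnion R).card ≤
      (rootSet q N U).card := (Nat.mul_le_mul_left _ h2).trans (hN.trans hNle)
  have h5 := Nat.mul_le_mul_left (2 * K) h3
  rw [mul_add] at h5
  refine Nat.le_of_mul_le_mul_left ?_ (by norm_num : 0 < 2)
  calc _ = _ := by ring
    _ ≤ _ := h5
    _ ≤ _ := by omega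

end addRoot

lemma IsRooted.rootFamily {α : Type*} [DecidableEq α] {k q K N : ℕ} {L : Finset ℕ}
    {G : Finset (Finset α)} {U : Finset α} (h : IsRooted k q (2 * K * q) L G U) (hq : 1 ≤ q)
    (hL0 : 0 ∉ L) (hL1 : 1 ∈ L) (hkL : k + 1 ∉ L) (hN0 : 0 < N)
    (hN : 2 * K * (q * G.card) ≤ N) :
    IsRooted (k + 1) q K L (rootFamily q N G U) ((rootSet q N U).disjSum ∅) := by
  have hmemU : ∀ v, v ∈ (rootSet q N U).disjSum (∅ : Finset (Fin q × α)) ↔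
      ∃ u ∈ rootSet q N U, v = Sum.inl u := by
    rintro (v | v) <;> simp
  refine ⟨?_, ?_, ?_, ?_, ?_, ?_, ?_⟩
  · obtain ⟨u, hu⟩ := h.nonempty
    exact ⟨Sum.inl (fun _ => u, ⟨0, hN0⟩), (hmemU _).mpr ⟨_, mem_rootSet.mpr fun _ => hu, rfl⟩⟩
  · intro X hX
    obtain ⟨w, -, j, A, hA, -, rfl⟩ := mem_rootFamily.mp hX
    rw [card_addRoot, h.uniform A hA]
  · intro X hX
    obtain ⟨w, hw, j, A, hA, -, rfl⟩ := mem_rootFamily.mp hX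
    rw [addRoot, disjSum_inter_disjSum, Finset.inter_empty, Finset.card_disjSum,
      Finset.singleton_inter_of_mem hw]
    simp
  · intro v hv
    obtain ⟨w, hw, rfl⟩ := (hmemU v).mp hv
    exact card_rootFamily_degree h hw
  · intro S hS hSc D hD
    by_cases hw : ∃ w, Sum.inl w ∈ D
    · obtain ⟨w, hw⟩ := hw
      exact not_pairwiseInter_of_inl_mem h hq hS hSc hw
    · push Not at hw
      exact not_pairwiseInter_of_inl_notMem h hq hL0 hkL hS hSc hD hw
  · intro S hS hSc D v hv hvD
    obtain ⟨w, hw, rfl⟩ := (hmemU v).mp hv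
    exact not_pairwiseInter_of_inl_mem h hq hS hSc hvD
  · intro F' hF' hav
    rw [Finset.card_disjSum, Finset.card_empty, add_zero]
    refine le_trans ?_ (mul_card_bad_roots_le h hL1 hq hN hF' hav)
    gcongr
    refine (Finset.card_le_card (t := ((rootSet q N U).filter fun w =>
      2 ≤ (F'.filter fun X => Sum.inl w ∈ X).card).image Sum.inl) ?_).trans Finset.card_image_le
    intro v hv
    rw [Finset.mem_filter] at hv
    obtain ⟨u, hu, rfl⟩ := (hmemU v).mp hv.1
    exact Finset.mem_image_of_mem _ (Finset.mem_filter.mpr ⟨hu, hv.2⟩)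

/-! ### Assembling the extremal family -/

lemma exists_isRooted {q : ℕ} (hq : 1 ≤ q) {L : Finset ℕ} (hL0 : 0 ∉ L) (hL1 : 1 ∈ L) (k : ℕ) :
    ∀ K : ℕ, ∃ (α : Type) (_ : DecidableEq α) (_ : Countable α) (F : Finset (Finset α))
      (U : Finset α), IsRooted k q K L F U := by
  induction k with
  | zero => exact fun K => ⟨Unit, inferInstance, inferInstance, _, _, isRooted_single q K hq L⟩
  | succ k ih =>
    intro K
    by_cases hkL : k + 1 ∈ L
    · obtain ⟨α, _, _, F, U, h⟩ := ih K
      exact ⟨_, inferInstance, inferInstance, _, _, h.leafFamily hq hkL⟩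
    · obtain ⟨α, _, _, G, U, h⟩ := ih (2 * K * q)
      exact ⟨_, inferInstance, inferInstance, _, _,
        h.rootFamily (N := 2 * K * (q * G.card) + 1) hq hL0 hL1 hkL (by omega) (by omega)⟩

lemma isTight_single (n q : ℕ) (hq : 1 ≤ q) (L : Finset ℕ) :
    IsTight n q 0 L {(Finset.univ : Finset (Fin n))} := by
  refine ⟨Finset.singleton_nonempty _, ?_, ?_, ?_⟩
  · intro A hA
    rw [Finset.mem_singleton.mp hA, Finset.card_univ, Fintype.card_fin]
  · intro S hS hSc
    have := Finset.card_le_card hS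
    rw [Finset.card_singleton] at this
    omega
  · intro F' hF' _
    have := Finset.card_le_card hF'
    rw [pow_zero, mul_one]
    omega

lemma exists_isTight {k q a b : ℕ} (hq : 1 ≤ q) {L : Finset ℕ} (hL : L ⊆ Finset.range k)
    (hab : a ≤ b) (hb : b ≤ k) (haL : a ∉ L) (hLa : ∀ i < a, i ∈ L)
    (hLb : ∀ i, a ≤ i → i ∈ L → b ≤ i) (hbL : b ∈ L ∨ b = k) :
    ∃ F : Finset (Finset ℕ), IsTight k q (k - b + a) L F := by
  have hshift : ∀ c, ∃ L' : Finset ℕ, ∀ l, l + c ∈ L ↔ l ∈ L' := fun c =>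
    ⟨(Finset.range k).filter fun l => l + c ∈ L, fun l => by
      rw [Finset.mem_filter, iff_and_self]
      intro h
      have := Finset.mem_range.mp (hL h)
      exact Finset.mem_range.mpr (by omega)⟩
  obtain ⟨L', hL'⟩ := hshift a
  have hrest : ∃ (α : Type) (_ : DecidableEq α) (_ : Countable α) (H : Finset (Finset α)),
      IsTight (k - a) q (k - b) L' H := by
    rcases eq_or_ne b k with rfl | hbk
    · rw [Nat.sub_self]
      exact ⟨_, inferInstance, inferInstance, _, isTight_single (b - a) q hq L'⟩
    · have hbL := hbL.resolve_right hbk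
      have hab' : a < b := lt_of_le_of_ne hab fun h => haL (h ▸ hbL)
      -- As `a ≤ b - 1 < b`, the size `b - 1` is not in `L`, so `L` shifted down by `b - 1` misses
      -- `0` and contains `1`. Of these `b - 1` points, `b - 1 - a` are put back as common points
      -- and the other `a` become parts of transversals, with one more point supplied by the root.
      obtain ⟨L₁, hL₁⟩ := hshift (b - 1)
      obtain ⟨α, _, _, F, U, h⟩ := exists_isRooted (L := L₁) hq
        (by
          rw [← hL₁]
          intro h
          have := hLb _ (by omega) h
          omega)
        (by rwa [← hL₁, Nat.add_sub_cancel' (by omega)]) (k - b) (q ^ (k - b))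
      have := (h.isTight hq).add_common (c := b - 1 - a) (L := L') hq fun l => by
        rw [← hL', ← hL₁, add_assoc, Nat.sub_add_cancel (by omega)]
      rw [show k - b + 1 + (b - 1 - a) = k - a by omega] at this
      exact ⟨_, inferInstance, inferInstance, _, this⟩
  obtain ⟨α, _, _, H, hH⟩ := hrest
  have hF := hH.transversalJoin (a := a) hq hL' hLa
  rw [Nat.sub_add_cancel (hab.trans hb)] at hF
  obtain ⟨f, hf⟩ := Countable.exists_injective_nat ((Fin a × Fin q) ⊕ ((Fin a → Fin q) × α))
  exact ⟨_, hF.map hq ⟨f, hf⟩⟩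

theorem theorem1p2 (k : ℕ) (hk : 1 ≤ k) :
    ∃ c C : ℝ, 0 < c ∧ 0 < C ∧
      ∀ (L : Finset ℕ) (m a b : ℕ), L ⊆ Finset.range k → 2 ≤ m →
        IsLeast {i : ℕ | i ∉ L} a →
        IsLeast {i : ℕ | a ≤ i ∧ (i ∈ L ∨ i = k)} b →
        -- the lower bound, for every finite family over every ground set
        (∀ (α : Type*) [DecidableEq α] (F : Finset (Finset α)), IsUniform k F →
          (¬ HasLClique L m F → ¬ HasLSunflower L m F) ∧
          (¬ HasLSunflower L m F →
            ∃ F' ⊆ F, AvoidsIntersections L F' ∧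
              c * (m : ℝ) ^ (-(k : ℤ) + (b : ℤ) - (a : ℤ)) * (F.card : ℝ) ≤ (F'.card : ℝ))) ∧
        -- tightness
        (∃ F : Finset (Finset ℕ), F.Nonempty ∧ IsUniform k F ∧ ¬ HasLSunflower L m F ∧
          ∀ F' ⊆ F, AvoidsIntersections L F' →
            (F'.card : ℝ) ≤ C * (m : ℝ) ^ (-(k : ℤ) + (b : ℤ) - (a : ℤ)) * (F.card : ℝ)) := by
  set K : ℕ := k ^ k * 2 ^ (k + 2) * (2 * ((2 ^ k + 1) * k ^ 2)) ^ k with hK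
  have hKpos : (0 : ℝ) < K := by
    rw [hK]
    positivity
  refine ⟨(K : ℝ)⁻¹, 2 ^ k * 2, by positivity, by positivity, ?_⟩
  intro L m a b hL hm ha hb
  have haL : a ∉ L := ha.1
  have hLa : ∀ i < a, i ∈ L := fun i hi => by
    by_contra h
    exact absurd (ha.2 h) (by omega)
  have hak : a ≤ k := ha.2 fun h => by simpa using hL h
  have hab : a ≤ b := hb.1.1
  have hbk : b ≤ k := hb.2 ⟨hak, Or.inr rfl⟩
  have hLb : ∀ i, a ≤ i → i ∈ L → b ≤ i := fun i hi hiL => hb.2 ⟨hi, Or.inl hiL⟩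
  have hexp : -(k : ℤ) + (b : ℤ) - (a : ℤ) = -((k - b + a : ℕ) : ℤ) := by
    push_cast [Nat.cast_sub hbk]
    ring
  have hmpos : (0 : ℝ) < (m : ℝ) ^ (k - b + a) := by positivity
  rw [hexp, zpow_neg, zpow_natCast]
  refine ⟨?_, ?_⟩
  · intro α _ F hF
    refine ⟨fun h hs => h hs.hasLClique, fun h => ?_⟩
    obtain ⟨F', hF', hav, hle⟩ := exists_large_avoiding (m := m) hk (by omega) hab hbk hL hLa hLb
      hF fun S hS hc D hD hp => h ((hasLSunflower_iff hm).mpr ⟨S, hS, hc, D, hD, hp⟩)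
    refine ⟨F', hF', hav, ?_⟩
    rw [← mul_inv, inv_mul_le_iff₀ (by positivity)]
    exact_mod_cast hle
  · obtain ⟨F, hF⟩ := exists_isTight (q := m - 1) (by omega) hL hab hbk haL hLa hLb hb.1.2
    refine ⟨F, hF.nonempty, hF.uniform, ?_, ?_⟩
    · rw [hasLSunflower_iff hm]
      rintro ⟨S, hS, hc, D, hD, hp⟩
      exact hF.no_sunflower S hS (by omega) D hD hp
    · intro F' hF' hav
      have h1 := hF.avoid F' hF' hav
      have h2 : F'.card * m ^ (k - b + a) ≤ 2 ^ k * 2 * F.card := by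
        -- Since `m ≥ 2`, `m ≤ 2 * (m - 1)`; passing from `q = m - 1` to `m` costs at most `2 ^ k`.
        calc _ ≤ F'.card * (2 * (m - 1)) ^ (k - b + a) := by
              gcongr
              omega
          _ = 2 ^ (k - b + a) * (F'.card * (m - 1) ^ (k - b + a)) := by
              rw [mul_pow]
              ring
          _ ≤ 2 ^ k * (2 * F.card) := by
              gcongr
              · norm_num
              · omega
          _ = _ := by ring
      rw [mul_right_comm, ← div_eq_mul_inv, le_div_iff₀ hmpos]
      exact_mod_cast h2
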